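/- Let $q$ be a prime power and $\mathbb F_q$ the field with $q$ elements. There are constants $C,c>0$ depending only on $q$ such that the following holds. Let $N\ge 0$ be an integer and $G=\{x\in\mathbb F_q[t]:\deg x<N\}$. Let $\mathbb T=\{\sum_{i<0}a_it^i : a_i\in\mathbb F_q\}\subset\mathbb F_q((1/t))$, and for $y=\sum_i a_it^i\in\mathbb F_q((1/t))$ write $\{y\}=\sum_{i<0}a_it^i$. For a finite set $\Gamma\subset\mathbb T$ and a function $\kappa:\Gamma\to\mathbb N=\{0,1,2,\dots\}$, the Bohr set $B_\kappa(\Gamma)$ is $\{x\in G:\deg\{x\xi\}<-\kappa(\xi)\text{ for all }\xi\in\Gamma\}$ (where $\deg 0=-\infty$), and its rank is $\mathrm{rk}(B_\kappa(\Gamma))=|\Gamma|$; a Bohr set is always understood to come with its $\Gamma$ and $\kappa$. Let $B$ be a Bohr set, let $k\ge1$ and let $A,L,S_1,\dots,S_k\subset B$. Write $\beta(X)=|X\cap B|/|B|$ and put $\alpha=\beta(A)$, $\lambda=\beta(L)$, $\sigma_i=\beta(S_i)$. Identify sets with their characteristic functions, and let $f*g(x)=\frac1{|B|}\sum_{y\in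 B}f(y)g(x-y)$ and $\langle f,g\rangle_\beta=\frac1{|B|}\sum_{x\in B}f(x)\overline{g(x)}$. Then either 1. $\langle L*S_1*\cdots*S_k,A\rangle_\beta\ge\lambda\sigma_1\cdots\sigma_k\alpha/2$, or 2. for every integer $l\ge1$ there is a Bohr set $B'\subset B$ such that $$\mathrm{rk}(B')\le\mathrm{rk}(B)+C\lambda^{-2-1/l}\alpha^{-1/l}l^2\log(1/\alpha)\log(1/\sigma_k),$$ $$\beta(B')\ge\exp\left(-C\lambda^{-2-1/l}\alpha^{-1/l}l^2\log(1/\alpha)\log(1/\sigma_k)\right),$$ and, for some $x\in B$, $\displaystyle\frac{|(A+x)\cap B'|}{|B'|}\ge\alpha(1+c\lambda)$. -/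

import Mathlib

open scoped BigOperators

noncomputable section

namespace FqtBohr

/-- `F((1/t))`, realised as Laurent series over `F` in the variable `X = 1/t`: the coefficient of
`t ^ i` in `x` is `x.coeff (-i)`. -/
abbrev Kinf (F : Type*) [Field F] := LaurentSeries F

/-- The inclusion of `F[t]` in `F((1/t))`, sending `t` to `X⁻¹`. -/
def polyIncl (F : Type*) [Field F] : Polynomial F →ₐ[F] Kinf F :=
  Polynomial.aeval (HahnSeries.single (-1 : ℤ) (1 : F))

/-- The degree in `t` of an element of `F((1/t))`, with `deg 0 = -∞`. -/
def deg {F : Type*} [Field F] (x : Kinf F) : WithBot ℤ :=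
  open Classical in if x = 0 then ⊥ else ((-x.order : ℤ) : WithBot ℤ)

/-- The fractional part `{x}`, the part of `x` with negative powers of `t`. -/
def fract {F : Type*} [Field F] (x : Kinf F) : Kinf F where
  coeff n := if 0 < n then x.coeff n else 0
  isPWO_support' := x.isPWO_support.mono (by
    intro n hn
    simp only [Function.mem_support, ne_eq, ite_eq_right_iff, not_forall] at hn
    exact hn.2)

/-- The dual group `𝕋` of `F[t]`: the series with only negative powers of `t`. -/
def dualT (F : Type*) [Field F] : Set (Kinf F) :=
  {ξ | ∀ n : ℤ, n ≤ 0 → ξ.coeff n = 0}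

/-- `G_N`, the space of polynomials over `F` of degree strictly less than `N`. -/
abbrev G (F : Type*) [Field F] (N : ℕ) := ↥(Polynomial.degreeLT F N)

instance instFintypeG (F : Type*) [Field F] [Fintype F] (N : ℕ) : Fintype (G F N) :=
  open Classical in Fintype.ofEquiv (Fin N → F) (Polynomial.degreeLTEquiv F N).symm.toEquiv

/-- A Bohr set is given by a finite set `Γ ⊆ 𝕋` of frequencies and a function `κ : Γ → ℕ`. -/
structure Bohr (F : Type*) [Field F] where
  Γ : Finset (Kinf F)
  subset_dual : (Γ : Set (Kinf F)) ⊆ dualT F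
  κ : {ξ // ξ ∈ Γ} → ℕ

/-- The rank of a Bohr set is the number of frequencies. -/
def Bohr.rk {F : Type*} [Field F] (B : Bohr F) : ℕ := B.Γ.card

/-- The elements of the Bohr set:
`B_κ(Γ) = {x ∈ G_N : deg {x ξ} < -κ(ξ) for all ξ ∈ Γ}`. -/
def Bohr.set {F : Type*} [Field F] [Fintype F] (B : Bohr F) (N : ℕ) : Finset (G F N) :=
  open Classical in
  Finset.univ.filter fun x : G F N =>
    ∀ ξ : {ξ // ξ ∈ B.Γ},
      deg (fract (polyIncl F (x : Polynomial F) * (ξ : Kinf F))) < ((-(B.κ ξ : ℤ) : ℤ) : WithBot ℤ)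

section Group

variable {H : Type*} [AddCommGroup H]

/-- The relative density `μ_X(A) = |A ∩ X| / |X|`. -/
def density (X A : Finset H) : ℝ :=
  open Classical in ((A ∩ X).card : ℝ) / (X.card : ℝ)

/-- The characteristic function of a set. -/
def ind (A : Finset H) (x : H) : ℝ :=
  open Classical in if x ∈ A then 1 else 0

/-- The translate `A + x`. -/
def translate (A : Finset H) (x : H) : Finset H := A.map (addRightEmbedding x)

/-- `⟨f, g⟩_{μ_X} = 𝔼_{x ∈ X} f(x) g(x)`, for real-valued functions. -/
def innerOn (X : Finset H) (f g : H → ℝ) : ℝ := X.expect fun x => f x * g x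

/-- Convolution over `X`: `(f * g)(x) = 𝔼_{y ∈ X} f(y) g(x - y)`. -/
def conv (X : Finset H) (f g : H → ℝ) (x : H) : ℝ := X.expect fun y => f y * g (x - y)

/-- The iterated convolution `f * g_1 * ⋯ * g_k` over `X`. -/
def iterConv (X : Finset H) (f : H → ℝ) : (k : ℕ) → (Fin k → H → ℝ) → H → ℝ
  | 0, _ => f
  | k + 1, g => conv X (iterConv X f k fun i => g i.castSucc) (g (Fin.last k))

end Group

end FqtBohr

end

open scoped BigOperators

namespace FqtBohr

open Finset Module

/-! Over `F[t]` a Bohr set is an `F`-subspace, so the problem lives on a finite vector space `V`,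
and each linear functional made to vanish costs one frequency and a factor `q` of density. The sets
`S_i` enter only through the normalised convolution `U` of all of them, a function into `[0, 1]` of
mean `σ_k`, so a failure of the lower bound says that `𝔼 U · corr L A` is too small.

Croot–Sisask sampling from `A` gives a dense set `T` of approximate periods of `corr L A`
(`exists_almostPeriods`). Averaging `l` times over `T - T` therefore hardly changes the pairing with
`U` (`exists_diffAvg_close`). On the Fourier side this average multiplies by powers of the squared
coefficients of `T`. By a Chang-type bound (`card_mul_le_log`) the large spectrum lies in the span
of few functionals, whose common kernel is `K`. Since `A - avg K A` has no Fourier mass on that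
span, `l` averages shrink its `L²` norm by `ζ ^ l`. Hence `A` may be replaced by `avg K A`
(`exists_functionals`).

The averaged correlation is then still too small somewhere. Since `L` has density `λ`, the deficit
on a translate of `L` forces `avg K A` to exceed `α (1 + λ / 4)` off it. For `σ_k` close to `1` the
same argument is run with `1 - U`, with an excess on `L` in place of a deficit
(`exists_density_increment`). -/

/-! ### Moments of sums of independent bounded samples -/

/-- Hoeffding's lemma: convexity puts the exponential below its chord on `[-1, 1]`, and centring
leaves only `cosh t`. -/
lemma expect_exp_le {ι : Type*} (s : Finset ι) (hs : s.Nonempty) (X : ι → ℝ)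
    (hX : ∀ i ∈ s, |X i| ≤ 1) (h0 : s.expect X = 0) (t : ℝ) :
    (s.expect fun i => Real.exp (t * X i)) ≤ Real.exp (t ^ 2 / 2) := by
  have key : ∀ i ∈ s, Real.exp (t * X i) ≤ Real.cosh t + Real.sinh t * X i := by
    intro i hi
    obtain ⟨h1, h2⟩ := abs_le.1 (hX i hi)
    have := convexOn_exp.2 (Set.mem_univ t) (Set.mem_univ (-t))
      (show 0 ≤ (1 + X i) / 2 by linarith) (show 0 ≤ (1 - X i) / 2 by linarith) (by ring)
    simp only [smul_eq_mul] at this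
    rw [Real.cosh_eq, Real.sinh_eq]
    calc Real.exp (t * X i) = Real.exp ((1 + X i) / 2 * t + (1 - X i) / 2 * -t) := by ring_nf
      _ ≤ _ := this
      _ = _ := by ring
  calc _ ≤ s.expect fun i => Real.cosh t + Real.sinh t * X i := expect_le_expect key
    _ = Real.cosh t := by
      rw [expect_add_distrib, expect_const hs, ← mul_expect, h0, mul_zero, add_zero]
    _ ≤ _ := Real.cosh_le_exp_half_sq t

lemma expect_piFinset_prod {V : Type*} {n : ℕ} (A : Finset V) (f : V → ℝ) :
    ((Fintype.piFinset fun _ : Fin n => A).expect fun a => ∏ j, f (a j)) = (A.expect f) ^ n := by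
  rw [expect_eq_sum_div_card, expect_eq_sum_div_card, Fintype.card_piFinset, div_pow,
    ← Finset.prod_univ_sum]
  simp

lemma pow_le_exp_add_exp (y : ℝ) (m : ℕ) :
    y ^ (2 * m) ≤ (2 * m).factorial * (Real.exp y + Real.exp (-y)) := by
  have h := Real.pow_div_factorial_le_exp |y| (abs_nonneg y) (2 * m)
  rw [div_le_iff₀ (by positivity)] at h
  rw [← Even.pow_abs (even_two_mul m)]
  refine h.trans ?_
  rw [mul_comm]
  gcongr
  rcases abs_cases y with ⟨h, _⟩ | ⟨h, _⟩ <;> rw [h]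
  · linarith [Real.exp_pos (-y)]
  · linarith [Real.exp_pos y]

lemma expect_sum_pow_le {V : Type*} (A : Finset V) (hA : A.Nonempty) (X : V → ℝ)
    (hX : ∀ i ∈ A, |X i| ≤ 1) (h0 : A.expect X = 0) {n m : ℕ} (hn : 1 ≤ n) (hm : 1 ≤ m) :
    ((Fintype.piFinset fun _ : Fin n => A).expect fun a => (∑ j, X (a j)) ^ (2 * m))
      ≤ 2 * (6 * m * n : ℝ) ^ m := by
  have hn' : (0 : ℝ) < n := by exact_mod_cast hn
  have hm' : (0 : ℝ) < m := by exact_mod_cast hm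
  -- This `t` makes the exponential moment at most `exp m`; with `(2m)! ≤ (2m)^(2m)` and `e ≤ 3` the
  -- base becomes `6mn`.
  set t : ℝ := Real.sqrt (2 * m / n) with ht
  have ht2 : t ^ 2 = 2 * m / n := Real.sq_sqrt (by positivity)
  have ht0 : 0 < t := Real.sqrt_pos.2 (by positivity)
  set P := Fintype.piFinset fun _ : Fin n => A
  have hexp : ∀ r : ℝ, r ^ 2 = 2 * m / n →
      (P.expect fun a => Real.exp (r * ∑ j, X (a j))) ≤ Real.exp m := by
    intro r hr
    have : (P.expect fun a => Real.exp (r * ∑ j, X (a j)))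
        = (A.expect fun i => Real.exp (r * X i)) ^ n := by
      rw [← expect_piFinset_prod]
      simp only [Finset.mul_sum, Real.exp_sum, P]
    rw [this]
    calc _ ≤ (Real.exp (r ^ 2 / 2)) ^ n := by
          refine pow_le_pow_left₀ (expect_nonneg fun i _ => (Real.exp_pos _).le) ?_ n
          exact expect_exp_le A hA X hX h0 r
      _ = Real.exp m := by
          rw [← Real.exp_nat_mul, hr]; congr 1; field_simp
  have h1 : (P.expect fun a => (t * ∑ j, X (a j)) ^ (2 * m))
      ≤ (2 * m).factorial * (Real.exp m + Real.exp m) := by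
    calc _ ≤ P.expect fun a => ((2 * m).factorial : ℝ) *
          (Real.exp (t * ∑ j, X (a j)) + Real.exp ((-t) * ∑ j, X (a j))) := by
          refine expect_le_expect fun a _ => ?_
          rw [neg_mul]; exact pow_le_exp_add_exp _ _
      _ ≤ _ := by
          rw [← mul_expect, expect_add_distrib]
          gcongr
          · exact hexp t ht2
          · exact hexp (-t) (by rw [neg_sq, ht2])
  simp only [mul_pow, ← mul_expect] at h1
  rw [pow_mul t, ht2] at h1
  have hfac : ((2 * m).factorial : ℝ) ≤ ((2 * m : ℝ) ^ 2) ^ m := by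
    rw [← pow_mul]; exact_mod_cast Nat.factorial_le_pow (2 * m)
  have he : Real.exp m ≤ 3 ^ m := by
    rw [← mul_one (m : ℝ), Real.exp_nat_mul]
    gcongr
    linarith [Real.exp_one_lt_d9]
  have h2 : (2 * m / n : ℝ) ^ m * (P.expect fun a => (∑ j, X (a j)) ^ (2 * m))
      ≤ (2 * m / n : ℝ) ^ m * (2 * (6 * m * n : ℝ) ^ m) := by
    refine h1.trans ?_
    calc _ ≤ ((2 * m : ℝ) ^ 2) ^ m * (3 ^ m + 3 ^ m) := by gcongr
      _ = 2 * ((2 * m : ℝ) ^ 2 * 3) ^ m := by rw [mul_pow _ (3 : ℝ)]; ring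
      _ = 2 * (2 * m / n * (6 * m * n) : ℝ) ^ m := by congr 2; field_simp; norm_num
      _ = _ := by rw [mul_pow (2 * m / n : ℝ)]; ring
  exact le_of_mul_le_mul_left h2 (by positivity)

/-! ### Almost-periods of correlations by random sampling -/

lemma ind_nonneg {V : Type*} (A : Finset V) (x : V) : 0 ≤ ind A x := by unfold ind; split_ifs <;> norm_num

lemma ind_le_one {V : Type*} (A : Finset V) (x : V) : ind A x ≤ 1 := by unfold ind; split_ifs <;> norm_num

lemma expect_ind {V : Type*} [Fintype V] (A : Finset V) : univ.expect (ind A) = (A.card : ℝ) / Fintype.card V := by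
  classical
  simp [expect_eq_sum_div_card, ind, Finset.card_univ]

section

variable {V : Type*} [AddCommGroup V] [Fintype V]

lemma expect_add_right (f : V → ℝ) (r : V) :
    (univ.expect fun u => f (u + r)) = univ.expect f :=
  Fintype.expect_equiv (Equiv.addRight r) _ _ fun _ => rfl

lemma expect_sub_right (f : V → ℝ) (r : V) :
    (univ.expect fun u => f (u - r)) = univ.expect f :=
  Fintype.expect_equiv (Equiv.subRight r) _ _ fun _ => rfl

/-- The correlation `u ↦ 𝔼 y, f y * g (u + y)`. -/
noncomputable def corr (f g : V → ℝ) (u : V) : ℝ := univ.expect fun y => f y * g (u + y)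

lemma expect_ind_mul (A : Finset V) (f : V → ℝ) :
    (univ.expect fun x => ind A x * f x) = univ.expect (ind A) * A.expect f := by
  classical
  rcases A.eq_empty_or_nonempty with rfl | hA
  · simp [ind]
  have h : (A.card : ℝ) ≠ 0 := by exact_mod_cast hA.card_pos.ne'
  simp only [expect_eq_sum_div_card, ind, ite_mul, one_mul, zero_mul, sum_ite_mem, univ_inter]
  simp only [sum_const, nsmul_eq_mul, mul_one]
  field_simp

lemma corr_ind (A L : Finset V) (u : V) :
    corr (ind L) (ind A) u = univ.expect (ind A) * A.expect fun a => ind L (a - u) := by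
  rw [← expect_ind_mul]
  refine Fintype.expect_equiv (Equiv.addLeft u) _ _ fun y => ?_
  simp [mul_comm]

/-- Croot–Sisask: at least half of the `n`-tuples from `A` approximate the normalised correlation in
`L^{2m}`. If many diagonal shifts of one tuple `b` are good, that single approximant `g b` is close
to all the corresponding translates. -/
lemma exists_almostPeriods (A L : Finset V) (hA : A.Nonempty) {n m : ℕ} (hn : 1 ≤ n) (hm : 1 ≤ m) :
    ∃ (T : Finset V) (g : V → ℝ),
      (univ.expect (ind A)) ^ n / 2 ≤ univ.expect (ind T) ∧
      ∀ r ∈ T, (univ.expect fun u =>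
        (A.expect (fun a => ind L (a - (u + r))) - g u) ^ (2 * m)) ≤ (24 * m / n : ℝ) ^ m := by
  classical
  have hn' : (0 : ℝ) < n := by exact_mod_cast hn
  have hm' : (0 : ℝ) < m := by exact_mod_cast hm
  set e : V → ℝ := fun u => A.expect fun a => ind L (a - u) with he
  have he0 : ∀ u, 0 ≤ e u := fun u => expect_nonneg fun a _ => ind_nonneg _ _
  have he1 : ∀ u, e u ≤ 1 := fun u => expect_le hA fun a _ => ind_le_one _ _
  set g : (Fin n → V) → V → ℝ := fun a u => (∑ j, ind L (a j - u)) / n with hg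
  set P := Fintype.piFinset fun _ : Fin n => A with hP
  have hPne : P.Nonempty := by simp [hP, hA]
  set D : (Fin n → V) → ℝ := fun a => univ.expect fun u => (g a u - e u) ^ (2 * m) with hD
  have hD0 : ∀ a, 0 ≤ D a := fun a => expect_nonneg fun u _ => (even_two_mul m).pow_nonneg _
  have hmom : P.expect D ≤ 2 * (6 * m / n : ℝ) ^ m := by
    rw [hD, expect_comm]
    refine expect_le univ_nonempty fun u _ => ?_
    have := expect_sum_pow_le A hA (fun a => ind L (a - u) - e u)
      (fun a _ => abs_le.2 ⟨by linarith [ind_nonneg L (a - u), he1 u],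
        by linarith [ind_le_one L (a - u), he0 u]⟩)
      (by rw [expect_sub_distrib, expect_const hA]; simp [he]) hn hm
    have hrw : ∀ a : Fin n → V, (g a u - e u) ^ (2 * m)
        = (1 / (n : ℝ) ^ 2) ^ m * (∑ j, (ind L (a j - u) - e u)) ^ (2 * m) := by
      intro a
      rw [← one_div_pow, ← pow_mul, ← mul_pow]
      congr 1
      simp only [hg, sum_sub_distrib, sum_const, card_univ, Fintype.card_fin, nsmul_eq_mul]
      field_simp
    simp only [hrw, ← mul_expect]
    calc _ ≤ (1 / (n : ℝ) ^ 2) ^ m * (2 * (6 * m * n : ℝ) ^ m) := by gcongr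
      _ = 2 * ((1 / (n : ℝ) ^ 2) * (6 * m * n)) ^ m := by rw [mul_pow]; ring
      _ = _ := by congr 2; field_simp
  -- The constant `24 = 4 · 6` makes `M` at least twice the mean of `D`, so Markov's inequality
  -- keeps half of the tuples.
  set M : ℝ := (24 * m / n : ℝ) ^ m with hM
  have hMpos : 0 < M := by positivity
  have hM4 : 4 * (6 * m / n : ℝ) ^ m ≤ M := by
    have : (24 * m / n : ℝ) = 4 * (6 * m / n) := by ring
    rw [hM, this, mul_pow]
    gcongr
    calc (4 : ℝ) = 4 ^ 1 := by norm_num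
      _ ≤ 4 ^ m := pow_le_pow_right₀ (by norm_num) hm
  set Gd : Finset (Fin n → V) := P.filter fun a => D a ≤ M with hGd
  have hcard : (P.card : ℝ) / 2 ≤ Gd.card := by
    have h1 : ((P.filter fun a => ¬ D a ≤ M).card : ℝ) * M ≤ P.card * (M / 2) := by
      calc _ = ∑ a ∈ P.filter fun a => ¬ D a ≤ M, M := by simp
        _ ≤ ∑ a ∈ P.filter fun a => ¬ D a ≤ M, D a :=
            sum_le_sum fun a ha => (not_le.1 (mem_filter.1 ha).2).le
        _ ≤ ∑ a ∈ P, D a := sum_le_sum_of_subset_of_nonneg (filter_subset _ _) fun a _ _ => hD0 a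
        _ = P.card * P.expect D := by
            rw [expect_eq_sum_div_card]
            have : (P.card : ℝ) ≠ 0 := by exact_mod_cast hPne.card_pos.ne'
            rw [mul_div_cancel₀ _ this]
        _ ≤ _ := by gcongr; linarith
    have h2 : ((P.filter fun a => ¬ D a ≤ M).card : ℝ) ≤ P.card / 2 := by
      refine le_of_mul_le_mul_right ?_ hMpos
      linarith
    have h3 : (Gd.card : ℝ) + (P.filter fun a => ¬ D a ≤ M).card = P.card := by
      exact_mod_cast Finset.card_filter_add_card_filter_not (s := P) (fun a => D a ≤ M)
    linarith
  -- Averaging over `b`: some translate of the diagonal meets the good tuples with at least their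
  -- overall density.
  obtain ⟨b, -, hb⟩ : ∃ b ∈ (univ : Finset (Fin n → V)), univ.expect (ind Gd) ≤
      univ.expect fun r : V => ind Gd (b + fun _ => r) := by
    refine exists_le_of_le_expect univ_nonempty ?_
    rw [expect_comm]
    refine le_expect univ_nonempty fun r _ => ?_
    rw [expect_add_right (ind Gd) (fun _ => r)]
  refine ⟨univ.filter fun r => (b + fun _ => r) ∈ Gd, fun u => g b u, ?_, ?_⟩
  · have h1 : univ.expect (ind (univ.filter fun r : V => (b + fun _ => r) ∈ Gd))
        = univ.expect fun r : V => ind Gd (b + fun _ => r) := by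
      refine expect_congr rfl fun r _ => ?_
      simp [ind]
    rw [h1]
    refine le_trans ?_ hb
    rw [expect_ind, expect_ind, div_pow, Fintype.card_fun, Fintype.card_fin]
    have : (P.card : ℝ) = (A.card : ℝ) ^ n := by simp [hP]
    rw [← this, div_right_comm]
    push_cast
    gcongr
  · intro r hr
    have hr := (mem_filter.1 ((mem_filter.1 hr).2)).2
    refine le_trans (le_of_eq ?_) hr
    refine Eq.trans ?_ (expect_add_right (fun u => (g (b + fun _ => r) u - e u) ^ (2 * m)) r)
    refine expect_congr rfl fun u _ => ?_
    rw [← Even.pow_abs (even_two_mul m), abs_sub_comm, Even.pow_abs (even_two_mul m)]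
    simp [hg, he]

end

/-! ### Averaging over differences, tested against weights -/

section

variable {V : Type*} [AddCommGroup V]

/-- The average of the translates of `h` by the elements of `T`. -/
noncomputable def avg (T : Finset V) (h : V → ℝ) (u : V) : ℝ := T.expect fun r => h (u + r)

/-- The average of the translates of `h` by the differences of elements of `T`. -/
noncomputable def diffAvg (T : Finset V) (h : V → ℝ) (u : V) : ℝ :=
  T.expect fun r => T.expect fun r' => h (u + r - r')

lemma diffAvg_avg (T W : Finset V) (h : V → ℝ) :
    diffAvg T (avg W h) = avg W (diffAvg T h) := by
  funext u
  unfold diffAvg avg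
  rw [expect_comm W]
  refine expect_congr rfl fun r _ => ?_
  rw [expect_comm W]
  refine expect_congr rfl fun r' _ => expect_congr rfl fun w _ => ?_
  congr 1; abel

lemma diffAvg_sub (T : Finset V) (f g : V → ℝ) :
    diffAvg T (f - g) = diffAvg T f - diffAvg T g := by
  funext u
  simp [diffAvg, expect_sub_distrib]

lemma diffAvg_iterate_sub (T : Finset V) (l : ℕ) (f g : V → ℝ) :
    (diffAvg T)^[l] (f - g) = (diffAvg T)^[l] f - (diffAvg T)^[l] g := by
  induction l generalizing f g with
  | zero => rfl
  | succ l ih => rw [Function.iterate_succ_apply, diffAvg_sub, ih]; rfl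

lemma diffAvg_iterate_avg (T W : Finset V) (l : ℕ) (h : V → ℝ) :
    (diffAvg T)^[l] (avg W h) = avg W ((diffAvg T)^[l] h) := by
  induction l generalizing h with
  | zero => rfl
  | succ l ih => rw [Function.iterate_succ_apply, diffAvg_avg, ih]; rfl

variable [Fintype V]

lemma diffAvg_corr (T : Finset V) (f g : V → ℝ) : diffAvg T (corr f g) = corr f (diffAvg T g) := by
  funext u
  simp only [diffAvg, corr, mul_expect]
  rw [expect_comm univ]
  refine expect_congr rfl fun r _ => ?_
  rw [expect_comm univ]
  refine expect_congr rfl fun r' _ => expect_congr rfl fun w _ => ?_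
  congr 2; abel

lemma diffAvg_iterate_corr (T : Finset V) (l : ℕ) (f g : V → ℝ) :
    (diffAvg T)^[l] (corr f g) = corr f ((diffAvg T)^[l] g) := by
  induction l generalizing g with
  | zero => rfl
  | succ l ih => rw [Function.iterate_succ_apply, diffAvg_corr, ih]; rfl

/-- Self-adjointness, because the distribution of `r - r'` is symmetric. -/
lemma expect_mul_diffAvg (T : Finset V) (U h : V → ℝ) :
    (univ.expect fun u => U u * diffAvg T h u) = univ.expect fun u => diffAvg T U u * h u := by
  simp only [diffAvg, mul_expect, expect_mul]
  rw [expect_comm univ, expect_comm univ]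
  calc _ = T.expect fun r => T.expect fun r' => univ.expect fun u => U u * h (u + r - r') := by
        exact expect_congr rfl fun r _ => expect_comm _ _ _
    _ = T.expect fun r => T.expect fun r' => univ.expect fun u => U (u + r' - r) * h u := by
        refine expect_congr rfl fun r _ => expect_congr rfl fun r' _ => ?_
        rw [← expect_add_right (fun u => U (u + r' - r) * h u) (r - r')]
        refine expect_congr rfl fun u _ => ?_
        congr 2 <;> abel
    _ = T.expect fun r => T.expect fun r' => univ.expect fun u => U (u + r - r') * h u :=
        expect_comm _ _ _
    _ = _ := expect_congr rfl fun r _ => expect_comm _ _ _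

lemma expect_mul_diffAvg_iterate (T : Finset V) (l : ℕ) (U h : V → ℝ) :
    (univ.expect fun u => U u * (diffAvg T)^[l] h u)
      = univ.expect fun u => (diffAvg T)^[l] U u * h u := by
  induction l generalizing U h with
  | zero => rfl
  | succ l ih =>
    rw [Function.iterate_succ_apply, ih, expect_mul_diffAvg, Function.iterate_succ_apply']

/-- A function with values in `[0, 1]` and mean `s`. -/
structure IsWeight (U : V → ℝ) (s : ℝ) : Prop where
  nonneg : ∀ u, 0 ≤ U u
  le_one : ∀ u, U u ≤ 1
  mean : univ.expect U = s

lemma IsWeight.shift {U : V → ℝ} {s : ℝ} (hU : IsWeight U s) (r : V) :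
    IsWeight (fun u => U (u + r)) s :=
  ⟨fun u => hU.nonneg _, fun u => hU.le_one _, by rw [expect_add_right U r, hU.mean]⟩

lemma IsWeight.diffAvg {U : V → ℝ} {s : ℝ} (hU : IsWeight U s) {T : Finset V} (hT : T.Nonempty) :
    IsWeight (diffAvg T U) s := by
  refine ⟨fun u => expect_nonneg fun r _ => expect_nonneg fun r' _ => hU.nonneg _,
    fun u => expect_le hT fun r _ => expect_le hT fun r' _ => hU.le_one _, ?_⟩
  unfold FqtBohr.diffAvg
  rw [expect_comm]
  calc _ = T.expect fun _ => s := by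
        refine expect_congr rfl fun r _ => ?_
        rw [expect_comm]
        calc _ = T.expect fun _ => s := by
              refine expect_congr rfl fun r' _ => ?_
              rw [← hU.mean, ← expect_add_right U (r - r')]
              refine expect_congr rfl fun u _ => ?_
              congr 1; abel
          _ = s := expect_const hT s
    _ = s := expect_const hT s

lemma IsWeight.diffAvg_iterate {U : V → ℝ} {s : ℝ} (hU : IsWeight U s) {T : Finset V}
    (hT : T.Nonempty) (l : ℕ) : IsWeight ((FqtBohr.diffAvg T)^[l] U) s := by
  induction l with
  | zero => exact hU
  | succ l ih => rw [Function.iterate_succ_apply']; exact ih.diffAvg hT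

/-- Jensen for the probability weights `U / (s |V|)`. Bounding `U` by `1` costs a factor `1 / s`,
which the `2m`-th root makes harmless when `m` is about `log (1 / s)`. -/
lemma IsWeight.abs_expect_mul_le {U : V → ℝ} {s : ℝ} (hU : IsWeight U s) (hs : 0 < s)
    (h : V → ℝ) {m : ℕ} (hm : 1 ≤ m) {β : ℝ} (hβ : 0 ≤ β)
    (hh : (univ.expect fun u => h u ^ (2 * m)) ≤ s * β ^ (2 * m)) :
    |univ.expect fun u => U u * h u| ≤ s * β := by
  have hN : (0 : ℝ) < Fintype.card V := by exact_mod_cast Fintype.card_pos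
  have hsum : ∑ u, U u = s * Fintype.card V := by
    rw [← hU.mean, Fintype.expect_eq_sum_div_card]; field_simp
  have h1 := Real.pow_arith_mean_le_arith_mean_pow univ (fun u => U u / (s * Fintype.card V))
    (fun u => |h u|) (fun u _ => div_nonneg (hU.nonneg u) (by positivity))
    (by rw [← sum_div, hsum, div_self (by positivity)]) (fun u _ => abs_nonneg _) (2 * m)
  have h2 : ∑ u, U u / (s * Fintype.card V) * |h u| ^ (2 * m) ≤ β ^ (2 * m) := by
    calc _ ≤ ∑ u, 1 / (s * Fintype.card V) * h u ^ (2 * m) := by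
          refine sum_le_sum fun u _ => ?_
          rw [Even.pow_abs (even_two_mul m)]
          have := (even_two_mul m).pow_nonneg (h u)
          gcongr
          exact hU.le_one u
      _ = (univ.expect fun u => h u ^ (2 * m)) / s := by
          rw [← mul_sum, Fintype.expect_eq_sum_div_card]; field_simp
      _ ≤ _ := by rw [div_le_iff₀ hs]; linarith
  have h3 := le_of_pow_le_pow_left₀ (by omega) hβ (h1.trans h2)
  calc _ ≤ univ.expect fun u => |U u * h u| := abs_expect_le _ _
    _ = s * ∑ u, U u / (s * Fintype.card V) * |h u| := by
        rw [Fintype.expect_eq_sum_div_card, mul_sum, sum_div]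
        refine sum_congr rfl fun u _ => ?_
        rw [abs_mul, abs_of_nonneg (hU.nonneg u)]
        field_simp
    _ ≤ _ := by gcongr

lemma exists_diffAvg_close (A L : Finset V) (hA : A.Nonempty) {n m : ℕ} (hn : 1 ≤ n) (hm : 1 ≤ m)
    {s β : ℝ} (hs : 0 < s) (hβ : 0 ≤ β) (hnm : (24 * m / n : ℝ) ^ m ≤ s * β ^ (2 * m)) :
    ∃ T : Finset V, (univ.expect (ind A)) ^ n / 2 ≤ univ.expect (ind T) ∧ T.Nonempty ∧
      ∀ (l : ℕ) (U : V → ℝ), IsWeight U s →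
        |(univ.expect fun u => U u * (diffAvg T)^[l] (corr (ind L) (ind A)) u)
          - univ.expect fun u => U u * corr (ind L) (ind A) u|
        ≤ l * (2 * univ.expect (ind A) * s * β) := by
  obtain ⟨T, g, hT, hg⟩ := exists_almostPeriods A L hA hn hm
  set α := univ.expect (ind A) with hα
  have hα0 : 0 < α := by
    rw [hα, expect_ind]
    have : (0 : ℝ) < A.card := by exact_mod_cast hA.card_pos
    have hN : (0 : ℝ) < Fintype.card V := by exact_mod_cast Fintype.card_pos
    positivity
  have hTne : T.Nonempty := by
    rw [nonempty_iff_ne_empty]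
    rintro rfl
    rw [expect_ind] at hT
    simp only [card_empty, Nat.cast_zero, zero_div] at hT
    linarith [pow_pos hα0 n]
  set f := corr (ind L) (ind A) with hf
  have h1 : ∀ r ∈ T, ∀ U, IsWeight U s →
      |univ.expect fun u => U u * (f (u + r) - α * g u)| ≤ α * (s * β) := by
    intro r hr U hU
    have h := hU.abs_expect_mul_le hs _ hm hβ ((hg r hr).trans hnm)
    have heq : (univ.expect fun u => U u * (f (u + r) - α * g u))
        = α * univ.expect fun u => U u * (A.expect (fun a => ind L (a - (u + r))) - g u) := by
      rw [mul_expect]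
      refine expect_congr rfl fun u _ => ?_
      rw [hf, corr_ind]; ring
    rw [heq, abs_mul, abs_of_pos hα0]
    gcongr
  have h2 : ∀ U, IsWeight U s →
      |univ.expect fun u => U u * (diffAvg T f u - f u)| ≤ 2 * α * s * β := by
    intro U hU
    have heq : (univ.expect fun u => U u * (diffAvg T f u - f u))
        = T.expect fun r => T.expect fun r' => univ.expect fun u =>
          U u * (f (u + r - r') - f u) := by
      calc _ = univ.expect fun u => T.expect fun r => T.expect fun r' =>
            U u * (f (u + r - r') - f u) := by
            refine expect_congr rfl fun u _ => ?_
            simp only [← mul_expect, expect_sub_distrib, expect_const hTne]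
            rfl
        _ = _ := by
            rw [expect_comm]
            exact expect_congr rfl fun r _ => expect_comm _ _ _
    rw [heq]
    refine (abs_expect_le _ _).trans (expect_le hTne fun r hr =>
      (abs_expect_le _ _).trans (expect_le hTne fun r' hr' => ?_))
    -- After a shift by `r'`, both translates are compared with the common approximant `α g`.
    have e1 : (univ.expect fun u => U u * (f (u + r - r') - f u))
        = (univ.expect fun u => U (u + r') * (f (u + r) - α * g u))
          - univ.expect fun u => U (u + r') * (f (u + r') - α * g u) := by
      rw [← expect_sub_distrib, ← expect_add_right _ r']
      refine expect_congr rfl fun u _ => ?_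
      rw [show u + r' + r - r' = u + r by abel]; ring
    rw [e1]
    have a1 := h1 r hr _ (hU.shift r')
    have a2 := h1 r' hr' _ (hU.shift r')
    rw [abs_le] at *
    constructor <;> linarith [a1.1, a1.2, a2.1, a2.2]
  refine ⟨T, hT, hTne, fun l U hU => ?_⟩
  induction l with
  | zero => simp
  | succ l ih =>
    -- The first `l` averages act on the weight, which keeps its mean; adjointness moves them back
    -- to `f`, and the errors telescope.
    have h3 := h2 _ (hU.diffAvg_iterate hTne l)
    rw [← expect_mul_diffAvg_iterate T l U (fun u => diffAvg T f u - f u)] at h3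
    have e : (fun u => diffAvg T f u - f u) = diffAvg T f - f := rfl
    rw [e, diffAvg_iterate_sub] at h3
    simp only [Pi.sub_apply, mul_sub, expect_sub_distrib, ← Function.iterate_succ_apply] at h3
    push_cast
    rw [abs_le] at *
    constructor <;> linarith [h3.1, h3.2, ih.1, ih.2]

end

/-! ### Fourier analysis on a finite vector space and the large spectrum -/

section

variable {F V : Type*} [Field F] [AddCommGroup V] [Module F V]

lemma re_expect {ι : Type*} (s : Finset ι) (f : ι → ℂ) :
    (s.expect f).re = s.expect fun i => (f i).re := by
  rw [expect_eq_sum_div_card, expect_eq_sum_div_card, Complex.div_natCast_re, Complex.re_sum]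

lemma pi_surjective_of_linearIndependent {ι : Type*} [Finite ι] {φ : ι → Dual F V}
    (hφ : LinearIndependent F φ) : Function.Surjective (LinearMap.pi φ) := by
  have h1 : LinearIndependent F fun i => (φ i : V → F) :=
    hφ.map' (LinearMap.ltoFun F V F F) (LinearMap.ker_eq_bot.2 DFunLike.coe_injective)
  rw [← span_flip_eq_top_iff_linearIndependent] at h1
  rw [← LinearMap.range_eq_top, ← h1]
  have : Set.range (flip fun i => (φ i : V → F)) = LinearMap.range (LinearMap.pi φ) := by
    ext y; rfl
  rw [this, Submodule.span_eq]

variable [Fintype V]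

lemma expect_comp_surjective {H M : Type*} [AddCommGroup H] [Fintype H] [AddCommGroup M]
    [Module ℚ≥0 M] (Φ : V →+ H) (hΦ : Function.Surjective Φ) (h : H → M) :
    (univ.expect fun x => h (Φ x)) = univ.expect h := by
  choose v hv using hΦ
  have h1 : ∀ w : H, (univ.expect fun x => h (Φ x + w)) = univ.expect fun x => h (Φ x) := by
    intro w
    refine Fintype.expect_equiv (Equiv.addRight (v w)) _ _ fun x => ?_
    simp [hv]
  calc _ = univ.expect fun w => univ.expect fun x => h (Φ x + w) := by
        simp only [h1]; rw [Fintype.expect_const]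
    _ = univ.expect fun _ : V => univ.expect h := by
        rw [expect_comm]
        refine expect_congr rfl fun x _ => ?_
        exact Fintype.expect_equiv (Equiv.addLeft (Φ x)) _ _ fun _ => rfl
    _ = _ := Fintype.expect_const _

/-- The Fourier coefficient of `h` at the functional `φ`. -/
noncomputable def fourier (ψ : AddChar F ℂ) (h : V → ℝ) (φ : Dual F V) : ℂ :=
  univ.expect fun u => (h u : ℂ) * ψ (φ u)

lemma sum_dual_addChar [Fintype (Dual F V)] [DecidableEq V] (ψ : AddChar F ℂ) {a : F}
    (hψ : ψ a ≠ 1) (x : V) :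
    ∑ φ : Dual F V, ψ (φ x) = if x = 0 then (Fintype.card (Dual F V) : ℂ) else 0 := by
  classical
  have h := AddChar.sum_eq_ite
    (ψ.compAddMonoidHom (LinearMap.applyₗ (R := F) (M₂ := F) x).toAddMonoidHom)
  have e : (ψ.compAddMonoidHom (LinearMap.applyₗ (R := F) (M₂ := F) x).toAddMonoidHom = 0)
      ↔ x = 0 := by
    constructor
    · intro h0
      by_contra hx
      obtain ⟨φ, hφ⟩ : ∃ φ : Dual F V, φ x ≠ 0 := by
        by_contra! H
        exact hx ((Module.forall_dual_apply_eq_zero_iff F x).1 H)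
      have := DFunLike.congr_fun h0 ((a / φ x) • φ)
      apply hψ
      simpa [hφ] using this
    · rintro rfl
      ext φ
      simp
  simp only [e] at h
  exact h

/-- Translating `h` by an element of `W` does not change its coefficient at a functional killing
`W`, so neither does averaging over `W`. -/
lemma fourier_eq_zero (ψ : AddChar F ℂ) {W : Finset V} (hW : W.Nonempty) {h : V → ℝ}
    (hh : avg W h = 0) {φ : Dual F V} (hφ : ∀ x ∈ W, φ x = 0) : fourier ψ h φ = 0 := by
  have h1 : ∀ w ∈ W, (univ.expect fun u => (h (u + w) : ℂ) * ψ (φ u)) = fourier ψ h φ := by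
    intro w hw
    refine Fintype.expect_equiv (Equiv.addRight w) _ _ fun u => ?_
    simp [hφ w hw]
  have h2 : (W.expect fun w => univ.expect fun u => (h (u + w) : ℂ) * ψ (φ u))
      = fourier ψ h φ := by
    rw [expect_congr rfl h1, expect_const hW]
  rw [← h2, expect_comm]
  refine expect_eq_zero fun u _ => ?_
  rw [← expect_mul]
  have := congrFun hh u
  rw [avg, Pi.zero_apply] at this
  have h3 : (W.expect fun w => (h (u + w) : ℂ)) = ((W.expect fun w => h (u + w) : ℝ) : ℂ) := by
    simp only [expect_eq_sum_div_card]; push_cast; rfl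
  rw [h3, this]; simp

variable [Fintype F]

lemma exists_addChar_apply_ne_one (F : Type*) [Field F] [Fintype F] :
    ∃ (ψ : AddChar F ℂ) (a : F), ψ a ≠ 1 := by
  obtain ⟨ψ, h⟩ := AddChar.exists_apply_ne_zero.2 (one_ne_zero : (1 : F) ≠ 0)
  exact ⟨ψ, 1, h⟩

/-- Linearly independent functionals are jointly uniform on `F^ι`, that is, independent random
variables. -/
lemma expect_prod_eq_prod_expect {ι : Type*} [Fintype ι] {φ : ι → Dual F V}
    (hφ : LinearIndependent F φ) (f : ι → F → ℝ) :
    (univ.expect fun x => ∏ i, f i (φ i x)) = ∏ i, univ.expect (f i) := by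
  classical
  have := expect_comp_surjective (LinearMap.pi φ).toAddMonoidHom
    (pi_surjective_of_linearIndependent hφ) fun y => ∏ i, f i (y i)
  refine Eq.trans this ?_
  simp only [Fintype.expect_eq_sum_div_card]
  rw [prod_div_distrib, prod_univ_sum, Fintype.piFinset_univ]
  simp

lemma expect_ind_ker {ι : Type*} [Fintype ι] {φ : ι → Dual F V} (hφ : LinearIndependent F φ)
    (W : Finset V) (hW : ∀ x, x ∈ W ↔ ∀ i, φ i x = 0) :
    univ.expect (ind W) = (Fintype.card F : ℝ)⁻¹ ^ Fintype.card ι := by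
  classical
  have h := expect_prod_eq_prod_expect hφ fun _ a => if a = 0 then 1 else 0
  have h1 : ∀ x, (∏ i, if φ i x = 0 then (1 : ℝ) else 0) = ind W x := by
    intro x
    rw [prod_ite_zero]
    simp [ind, hW]
  simp only [h1] at h
  rw [h]
  simp

lemma exists_norm_eq_one_mul_eq (z : ℂ) : ∃ w : ℂ, ‖w‖ = 1 ∧ w * z = ‖z‖ := by
  rcases eq_or_ne z 0 with rfl | hz
  · exact ⟨1, by simp⟩
  · refine ⟨(starRingEnd ℂ) z / ‖z‖, ?_, ?_⟩
    · simp [hz]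
    · have : (‖z‖ : ℂ) ≠ 0 := by simpa using hz
      field_simp
      rw [mul_comm, Complex.mul_conj']

/-- Chang's bound for linearly independent functionals in the large spectrum of `T`. -/
lemma card_mul_le_log (ψ : AddChar F ℂ) {a : F} (hψ : ψ a ≠ 1) {T : Finset V} (hT : T.Nonempty)
    {ι : Type*} [Fintype ι] {φ : ι → Dual F V} (hφ : LinearIndependent F φ) {ζ : ℝ} (hζ : 0 < ζ)
    (h : ∀ i, ζ ≤ ‖T.expect fun r => ψ (φ i r)‖ ^ 2) :
    Fintype.card ι * ζ ≤ 2 * Real.log (1 / univ.expect (ind T)) := by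
  choose w hw1 hw2 using fun i => exists_norm_eq_one_mul_eq (T.expect fun r => ψ (φ i r))
  have hτ : 0 < univ.expect (ind T) := by
    rw [expect_ind]
    have : (0 : ℝ) < T.card := by exact_mod_cast hT.card_pos
    have hN : (0 : ℝ) < Fintype.card V := by exact_mod_cast Fintype.card_pos
    positivity
  set η := Real.sqrt ζ with hη
  have hη2 : η ^ 2 = ζ := Real.sq_sqrt hζ.le
  have hη0 : 0 < η := Real.sqrt_pos.2 hζ
  set g : V → ℝ := fun x => ∑ i, η * (w i * ψ (φ i x)).re with hg
  set c : ℝ := Fintype.card ι * ζ with hc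
  have hgT : c ≤ T.expect g := by
    have e : T.expect g = ∑ i, η * ‖T.expect fun r => ψ (φ i r)‖ := by
      rw [hg, expect_sum_comm]
      refine sum_congr rfl fun i _ => ?_
      rw [← mul_expect]
      congr 1
      have := congrArg Complex.re (hw2 i)
      rw [Complex.ofReal_re, mul_expect] at this
      rw [← this, re_expect]
    rw [e]
    calc c = ∑ i : ι, η * η := by rw [← sq, hη2]; simp [hc]
      _ ≤ _ := by
        refine sum_le_sum fun i _ => ?_
        gcongr
        exact Real.sqrt_le_iff.2 ⟨norm_nonneg _, h i⟩
  -- Jensen, through the tangent line of `exp` at `c`. The phases `w i` make `g` large on `T`, while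
  -- independence keeps its exponential moment on `V` below `exp (c / 2)`.
  have h1 : Real.exp c ≤ T.expect fun x => Real.exp (g x) := by
    calc Real.exp c ≤ Real.exp c * (1 + (T.expect g - c)) := by
          refine le_mul_of_one_le_right (Real.exp_pos _).le (by linarith)
      _ = T.expect fun x => Real.exp c * (1 + (g x - c)) := by
          rw [← mul_expect, expect_add_distrib, expect_sub_distrib, expect_const hT,
            expect_const hT]
      _ ≤ _ := by
          refine expect_le_expect fun x _ => ?_
          calc _ ≤ Real.exp c * Real.exp (g x - c) := by
                gcongr
                linarith [Real.add_one_le_exp (g x - c)]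
            _ = _ := by rw [← Real.exp_add]; congr 1; ring
  have h2 : (univ.expect fun x => Real.exp (g x)) ≤ Real.exp (c / 2) := by
    have : (univ.expect fun x => Real.exp (g x))
        = ∏ i, univ.expect fun b => Real.exp (η * (w i * ψ b).re) := by
      rw [← expect_prod_eq_prod_expect hφ]
      simp only [hg, Real.exp_sum]
    rw [this]
    calc _ ≤ ∏ i : ι, Real.exp (η ^ 2 / 2) := by
          refine prod_le_prod (fun i _ => expect_nonneg fun _ _ => (Real.exp_pos _).le)
            fun i _ => expect_exp_le _ univ_nonempty _ (fun b _ => ?_) ?_ η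
          · refine (Complex.abs_re_le_norm _).trans ?_
            rw [norm_mul, hw1, AddChar.norm_apply, one_mul]
          · have h0 : (univ.expect fun b => ψ b) = 0 := by
              rw [AddChar.expect_eq_zero_iff_ne_zero]
              rintro rfl
              exact hψ (by simp)
            have h00 : (univ.expect fun b => w i * ψ b) = 0 := by
              rw [← mul_expect, h0, mul_zero]
            rw [← re_expect, h00, Complex.zero_re]
      _ = _ := by
          rw [prod_const, ← Real.exp_nat_mul, hη2, hc, card_univ]; congr 1; ring
  have h3 : univ.expect (ind T) * Real.exp c ≤ Real.exp (c / 2) := by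
    calc _ ≤ univ.expect (ind T) * T.expect fun x => Real.exp (g x) := by gcongr
      _ = univ.expect fun x => ind T x * Real.exp (g x) := (expect_ind_mul _ _).symm
      _ ≤ univ.expect fun x => Real.exp (g x) := by
          refine expect_le_expect fun x _ => ?_
          exact mul_le_of_le_one_left (Real.exp_pos _).le (ind_le_one T x)
      _ ≤ _ := h2
  have h4 := Real.log_le_log (by positivity) h3
  rw [Real.log_mul hτ.ne' (Real.exp_pos _).ne', Real.log_exp, Real.log_exp] at h4
  rw [one_div, Real.log_inv]
  linarith

lemma card_dual [Fintype (Dual F V)] : Fintype.card (Dual F V) = Fintype.card V := by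
  rw [Module.card_eq_pow_finrank (K := F) (V := Dual F V), Subspace.dual_finrank_eq,
    ← Module.card_eq_pow_finrank (K := F)]

lemma sum_norm_sq_fourier [Fintype (Dual F V)] (ψ : AddChar F ℂ) {a : F} (hψ : ψ a ≠ 1)
    (h : V → ℝ) :
    ∑ φ : Dual F V, ‖fourier ψ h φ‖ ^ 2 = univ.expect fun u => h u ^ 2 := by
  classical
  have hN : (Fintype.card V : ℂ) ≠ 0 := by exact_mod_cast Fintype.card_pos.ne'
  have e1 : ∀ φ : Dual F V, ((‖fourier ψ h φ‖ ^ 2 : ℝ) : ℂ)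
      = univ.expect fun u => univ.expect fun v => ((h u * h v : ℝ) : ℂ) * ψ (φ (u - v)) := by
    intro φ
    rw [Complex.ofReal_pow, ← Complex.mul_conj']
    have : (starRingEnd ℂ) (fourier ψ h φ) = univ.expect fun v => (h v : ℂ) * ψ (φ (-v)) := by
      rw [fourier]
      simp only [Fintype.expect_eq_sum_div_card, map_div₀, map_sum, map_mul, map_natCast,
        Complex.conj_ofReal, map_neg, AddChar.map_neg_eq_conj]
    rw [this, fourier, expect_mul_expect]
    refine expect_congr rfl fun u _ => expect_congr rfl fun v _ => ?_
    rw [sub_eq_add_neg, map_add, AddChar.map_add_eq_mul]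
    push_cast; ring
  have : ((∑ φ : Dual F V, ‖fourier ψ h φ‖ ^ 2 : ℝ) : ℂ)
      = ((univ.expect fun u => h u ^ 2 : ℝ) : ℂ) := by
    rw [Complex.ofReal_sum]
    simp only [e1]
    rw [← expect_sum_comm]
    simp only [← expect_sum_comm, ← mul_sum, sum_dual_addChar ψ hψ, card_dual, sub_eq_zero]
    simp only [Fintype.expect_eq_sum_div_card]
    simp [hN, sq]
  exact_mod_cast this

lemma fourier_diffAvg (ψ : AddChar F ℂ) (T : Finset V) (h : V → ℝ) (φ : Dual F V) :
    ‖fourier ψ (diffAvg T h) φ‖ = ‖T.expect fun r => ψ (φ r)‖ ^ 2 * ‖fourier ψ h φ‖ := by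
  have e : fourier ψ (diffAvg T h) φ
      = (T.expect fun r => ψ (φ (-r))) * (T.expect fun r => ψ (φ r)) * fourier ψ h φ := by
    rw [expect_mul_expect]
    simp only [expect_mul]
    unfold fourier diffAvg
    have : ∀ u, (((T.expect fun r => T.expect fun r' => h (u + r - r') : ℝ)) : ℂ) * ψ (φ u)
        = T.expect fun r => T.expect fun r' => (h (u + r - r') : ℂ) * ψ (φ u) := by
      intro u
      simp only [expect_eq_sum_div_card]
      push_cast
      simp only [sum_mul, sum_div, div_mul_eq_mul_div]
    simp only [this]
    rw [expect_comm]
    refine expect_congr rfl fun r _ => ?_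
    rw [expect_comm]
    refine expect_congr rfl fun r' _ => ?_
    rw [mul_expect]
    refine Fintype.expect_equiv (Equiv.addRight (r - r')) _ _ fun u => ?_
    have : φ u = φ (-r) + φ r' + φ (u + (r - r')) := by
      rw [← map_add, ← map_add]; congr 1; abel
    rw [this, AddChar.map_add_eq_mul, AddChar.map_add_eq_mul]
    simp only [Equiv.coe_addRight, ← add_sub_assoc]
    ring
  have e2 : ‖T.expect fun r => ψ (φ (-r))‖ = ‖T.expect fun r => ψ (φ r)‖ := by
    rw [← Complex.norm_conj]
    congr 1
    simp only [expect_eq_sum_div_card, map_div₀, map_sum, map_natCast, map_neg,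
      AddChar.map_neg_eq_conj, Complex.conj_conj]
  rw [e, norm_mul, norm_mul, e2, sq]

/-- By Plancherel: coefficients of `h` vanish on the large spectrum of `T`, and off it the
multiplier is below `ζ`. -/
lemma expect_diffAvg_sq_le [Fintype (Dual F V)] (ψ : AddChar F ℂ) {a : F} (hψ : ψ a ≠ 1)
    (T : Finset V) {W : Finset V} (hW : W.Nonempty) {ζ : ℝ}
    (hζ : ∀ φ : Dual F V, ζ ≤ ‖T.expect fun r => ψ (φ r)‖ ^ 2 → ∀ x ∈ W, φ x = 0)
    (h : V → ℝ) (hh : avg W h = 0) :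
    (univ.expect fun u => diffAvg T h u ^ 2) ≤ ζ ^ 2 * univ.expect fun u => h u ^ 2 := by
  rw [← sum_norm_sq_fourier ψ hψ, ← sum_norm_sq_fourier ψ hψ, mul_sum]
  refine sum_le_sum fun φ _ => ?_
  rw [fourier_diffAvg]
  by_cases hφ : ζ ≤ ‖T.expect fun r => ψ (φ r)‖ ^ 2
  · rw [fourier_eq_zero ψ hW hh (hζ φ hφ)]; simp
  · rw [mul_pow]
    gcongr
    exact (not_le.1 hφ).le

lemma expect_diffAvg_iterate_sq_le [Fintype (Dual F V)] (ψ : AddChar F ℂ) {a : F} (hψ : ψ a ≠ 1)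
    (T : Finset V) {W : Finset V} (hW : W.Nonempty) {ζ : ℝ}
    (hζ : ∀ φ : Dual F V, ζ ≤ ‖T.expect fun r => ψ (φ r)‖ ^ 2 → ∀ x ∈ W, φ x = 0)
    (h : V → ℝ) (hh : avg W h = 0) (l : ℕ) :
    (univ.expect fun u => (diffAvg T)^[l] h u ^ 2)
      ≤ (ζ ^ l) ^ 2 * univ.expect fun u => h u ^ 2 := by
  induction l with
  | zero => simp
  | succ l ih =>
    rw [Function.iterate_succ_apply']
    have h0 : avg W ((diffAvg T)^[l] h) = 0 := by
      rw [← diffAvg_iterate_avg, hh]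
      clear ih
      induction l with
      | zero => rfl
      | succ l ih =>
        rw [Function.iterate_succ_apply', ih]
        funext u; simp [diffAvg]
    calc _ ≤ ζ ^ 2 * univ.expect fun u => (diffAvg T)^[l] h u ^ 2 :=
          expect_diffAvg_sq_le ψ hψ T hW hζ _ h0
      _ ≤ ζ ^ 2 * ((ζ ^ l) ^ 2 * univ.expect fun u => h u ^ 2) := by gcongr
      _ = _ := by ring

end

/-! ### From a deviating correlation to a point of large average -/

lemma isWeight_ind {V : Type*} [Fintype V] (A : Finset V) : IsWeight (ind A) (univ.expect (ind A)) :=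
  ⟨ind_nonneg A, ind_le_one A, rfl⟩

lemma avg_sub_avg {V : Type*} [AddCommGroup V] {W : Finset V} (hW : W.Nonempty) (hadd : ∀ x ∈ W, ∀ y ∈ W, x + y ∈ W)
    (hneg : ∀ x ∈ W, -x ∈ W) (h : V → ℝ) : avg W (h - avg W h) = 0 := by
  funext u
  simp only [avg, Pi.sub_apply, expect_sub_distrib, Pi.zero_apply]
  have : ∀ w ∈ W, (W.expect fun r => h (u + w + r)) = W.expect fun r => h (u + r) := by
    intro w hw
    refine expect_nbij' (fun r => w + r) (fun r => -w + r) (fun r hr => hadd w hw r hr)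
      (fun r hr => hadd _ (hneg w hw) r hr) (by simp) (by simp) fun r _ => ?_
    rw [add_assoc]
  rw [expect_congr rfl this, expect_const hW, sub_self]

section

variable {V : Type*} [AddCommGroup V] [Fintype V]

lemma expect_corr (f g : V → ℝ) : univ.expect (corr f g) = univ.expect f * univ.expect g := by
  unfold corr
  rw [expect_comm, expect_mul]
  refine expect_congr rfl fun y _ => ?_
  rw [← mul_expect, expect_add_right]

lemma corr_sub (f g g' : V → ℝ) : corr f (g - g') = corr f g - corr f g' := by
  funext u
  simp [corr, mul_sub, expect_sub_distrib]

lemma expect_avg {W : Finset V} (hW : W.Nonempty) (h : V → ℝ) :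
    univ.expect (avg W h) = univ.expect h := by
  unfold avg
  rw [expect_comm]
  simp only [expect_add_right]
  exact expect_const hW _

lemma IsWeight.avg {U : V → ℝ} {s : ℝ} (hU : IsWeight U s) {W : Finset V} (hW : W.Nonempty) :
    IsWeight (avg W U) s :=
  ⟨fun u => expect_nonneg fun r _ => hU.nonneg _, fun u => expect_le hW fun r _ => hU.le_one _,
    by rw [expect_avg hW, hU.mean]⟩

lemma IsWeight.compl {U : V → ℝ} {s : ℝ} (hU : IsWeight U s) :
    IsWeight (fun u => 1 - U u) (1 - s) :=
  ⟨fun u => by linarith [hU.le_one u], fun u => by linarith [hU.nonneg u], by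
    rw [expect_sub_distrib, hU.mean, Fintype.expect_const]⟩

lemma abs_corr_le {f g : V → ℝ} (hf : ∀ u, |f u| ≤ 1) {z : ℝ} (hz : 0 ≤ z)
    (hg : (univ.expect fun u => g u ^ 2) ≤ z ^ 2) (u : V) : |corr f g u| ≤ z := by
  refine abs_le_of_sq_le_sq ?_ hz
  refine (expect_mul_sq_le_sq_mul_sq _ _ _).trans ?_
  rw [show (univ.expect fun y => g (u + y) ^ 2) = univ.expect fun y => g y ^ 2 from
    Fintype.expect_equiv (Equiv.addLeft u) _ _ fun _ => rfl]
  calc _ ≤ 1 * z ^ 2 := by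
        gcongr
        exact expect_le univ_nonempty fun y _ => (sq_le_one_iff_abs_le_one _).2 (hf y)
    _ = _ := one_mul _

/-- The mass missing on the translate of `L` sits on its complement, and `(1 - λ)(1 + λ/4) < 1 -
3λ/4`. -/
lemma exists_avg_ge_of_corr_le {A L W : Finset V} (hW : W.Nonempty) {u : V}
    (hα : 0 < univ.expect (ind A)) (hl : 0 < univ.expect (ind L))
    (hu : corr (ind L) (avg W (ind A)) u ≤ 3 / 4 * (univ.expect (ind L) * univ.expect (ind A))) :
    ∃ y, univ.expect (ind A) * (1 + 1 / 4 * univ.expect (ind L)) ≤ avg W (ind A) y := by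
  by_contra! H
  set α := univ.expect (ind A)
  set lam := univ.expect (ind L) with hlam
  have h1 : (univ.expect fun y => (1 - ind L y) * avg W (ind A) (u + y))
      = α - corr (ind L) (avg W (ind A)) u := by
    simp only [sub_mul, one_mul, expect_sub_distrib]
    congr 1
    rw [show (univ.expect fun y => avg W (ind A) (u + y)) = univ.expect (avg W (ind A)) from
      Fintype.expect_equiv (Equiv.addLeft u) _ _ fun _ => rfl, expect_avg hW]
  have h2 : (univ.expect fun y => (1 - ind L y) * avg W (ind A) (u + y))
      ≤ (1 - lam) * (α * (1 + 1 / 4 * lam)) := by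
    calc _ ≤ univ.expect fun y => (1 - ind L y) * (α * (1 + 1 / 4 * lam)) := by
          refine expect_le_expect fun y _ => ?_
          exact mul_le_mul_of_nonneg_left (H _).le (by linarith [ind_le_one L y])
      _ = _ := by rw [← expect_mul, expect_sub_distrib, Fintype.expect_const]
  nlinarith [mul_pos hα hl, mul_pos (mul_pos hα hl) hl]

/-- The excess lies on the translate of `L` itself, and `1 + λ/4 < 3/2`. -/
lemma exists_avg_ge_of_le_corr {A L W : Finset V} {u : V}
    (hα : 0 < univ.expect (ind A)) (hl : 0 < univ.expect (ind L))
    (hu : 3 / 2 * (univ.expect (ind L) * univ.expect (ind A)) ≤ corr (ind L) (avg W (ind A)) u) :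
    ∃ y, univ.expect (ind A) * (1 + 1 / 4 * univ.expect (ind L)) ≤ avg W (ind A) y := by
  by_contra! H
  set α := univ.expect (ind A)
  set lam := univ.expect (ind L) with hlam
  have hl1 : lam ≤ 1 := expect_le univ_nonempty fun y _ => ind_le_one L y
  have h2 : corr (ind L) (avg W (ind A)) u ≤ lam * (α * (1 + 1 / 4 * lam)) := by
    calc _ ≤ univ.expect fun y => ind L y * (α * (1 + 1 / 4 * lam)) := by
          refine expect_le_expect fun y _ => ?_
          exact mul_le_mul_of_nonneg_left (H _).le (ind_nonneg L y)
      _ = _ := by rw [← expect_mul]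
  nlinarith [mul_pos hα hl, mul_pos (mul_pos hα hl) hl]

end

/-! ### Replacing a set by its average over the annihilator of the spectrum -/

section

variable {F V : Type*} [Field F] [AddCommGroup V] [Module F V] [Fintype V]

open Classical in
/-- The common kernel of a finite set of functionals. -/
noncomputable def commonKer (b : Finset (Dual F V)) : Finset V :=
  univ.filter fun x => ∀ φ ∈ b, φ x = 0

lemma mem_commonKer {b : Finset (Dual F V)} {x : V} : x ∈ commonKer b ↔ ∀ φ ∈ b, φ x = 0 := by
  simp [commonKer]

lemma commonKer_nonempty (b : Finset (Dual F V)) : (commonKer b).Nonempty :=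
  ⟨0, mem_commonKer.2 fun φ _ => map_zero φ⟩

lemma avg_commonKer_sub (b : Finset (Dual F V)) (h : V → ℝ) :
    avg (commonKer b) (h - avg (commonKer b) h) = 0 := by
  refine avg_sub_avg (commonKer_nonempty b) (fun x hx y hy => ?_) (fun x hx => ?_) h
  · rw [mem_commonKer] at *
    intro φ hφ
    rw [map_add, hx φ hφ, hy φ hφ, add_zero]
  · rw [mem_commonKer] at *
    intro φ hφ
    rw [map_neg, hx φ hφ, neg_zero]

variable [Fintype F]

/-- A basis chosen inside the large spectrum is small by `card_mul_le_log`, and its common kernel is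
killed by the whole span. -/
lemma exists_spectrum_annihilator (ψ : AddChar F ℂ) {a : F} (hψ : ψ a ≠ 1) {T : Finset V}
    (hT : T.Nonempty) {ζ : ℝ} (hζ : 0 < ζ) :
    ∃ b : Finset (Dual F V),
      b.card * ζ ≤ 2 * Real.log (1 / univ.expect (ind T)) ∧
      univ.expect (ind (commonKer b)) = (Fintype.card F : ℝ)⁻¹ ^ b.card ∧
      ∀ φ : Dual F V, ζ ≤ ‖T.expect fun r => ψ (φ r)‖ ^ 2 → ∀ x ∈ commonKer b, φ x = 0 := by
  classical
  have : Finite (Dual F V) := Finite.of_injective (fun φ : Dual F V => (φ : V → F))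
    DFunLike.coe_injective
  obtain ⟨b, hb, hspan, hli⟩ := exists_linearIndependent F
    {φ : Dual F V | ζ ≤ ‖T.expect fun r => ψ (φ r)‖ ^ 2}
  have : Fintype b := Fintype.ofFinite b
  refine ⟨b.toFinset, ?_, ?_, ?_⟩
  · have := card_mul_le_log ψ hψ hT hli hζ fun i => hb i.2
    rwa [Set.toFinset_card]
  · rw [Set.toFinset_card]
    refine expect_ind_ker hli _ fun x => ?_
    rw [mem_commonKer]
    simp
  · intro φ hφ x hx
    have h1 : φ ∈ Submodule.span F b := by rw [hspan]; exact Submodule.subset_span hφ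
    rw [mem_commonKer] at hx
    have h2 : Submodule.span F b ≤ LinearMap.ker (LinearMap.applyₗ (R := F) (M₂ := F) x) := by
      rw [Submodule.span_le]
      intro χ hχ
      exact hx χ (Set.mem_toFinset.2 hχ)
    exact h2 h1

/-- The first error term is the cost of smoothing `corr L A`. The second comes from Cauchy–Schwarz
applied to the smoothed `A - avg K A`. The smoothing is finally moved onto the weight, giving `U'`.
-/
lemma exists_functionals (A L : Finset V) (hA : A.Nonempty) {n m l : ℕ} (hn : 1 ≤ n) (hm : 1 ≤ m)
    {s β ζ : ℝ} (hs : 0 < s) (hβ : 0 ≤ β) (hnm : (24 * m / n : ℝ) ^ m ≤ s * β ^ (2 * m))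
    (hζ : 0 < ζ) :
    ∃ b : Finset (Dual F V),
      b.card * ζ ≤ 2 * (n * Real.log (1 / univ.expect (ind A)) + Real.log 2) ∧
      univ.expect (ind (commonKer b)) = (Fintype.card F : ℝ)⁻¹ ^ b.card ∧
      ∀ U : V → ℝ, IsWeight U s → ∃ U', IsWeight U' s ∧
        |(univ.expect fun u => U' u * corr (ind L) (avg (commonKer b) (ind A)) u)
          - univ.expect fun u => U u * corr (ind L) (ind A) u|
        ≤ l * (2 * univ.expect (ind A) * s * β) + s * ζ ^ l := by
  classical
  have : Finite (Dual F V) := Finite.of_injective (fun φ : Dual F V => (φ : V → F))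
    DFunLike.coe_injective
  let : Fintype (Dual F V) := Fintype.ofFinite _
  obtain ⟨ψ, a, hψ⟩ := exists_addChar_apply_ne_one F
  obtain ⟨T, hT, hTne, hclose⟩ := exists_diffAvg_close A L hA hn hm hs hβ hnm
  obtain ⟨b, hb1, hb2, hb3⟩ := exists_spectrum_annihilator ψ hψ hTne hζ
  set α := univ.expect (ind A) with hα
  have hα0 : 0 < α := by
    rw [hα, expect_ind]
    have : (0 : ℝ) < A.card := by exact_mod_cast hA.card_pos
    have hN : (0 : ℝ) < Fintype.card V := by exact_mod_cast Fintype.card_pos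
    positivity
  set W := commonKer b with hW
  have hWne : W.Nonempty := commonKer_nonempty b
  refine ⟨b, hb1.trans ?_, hb2, fun U hU => ?_⟩
  · gcongr
    have hτ : 0 < univ.expect (ind T) := lt_of_lt_of_le (by positivity) hT
    calc Real.log (1 / univ.expect (ind T)) ≤ Real.log (1 / (α ^ n / 2)) := by gcongr
      _ = _ := by
        rw [one_div_div, Real.log_div two_ne_zero (by positivity), Real.log_pow, one_div,
          Real.log_inv]
        ring
  · refine ⟨(diffAvg T)^[l] U, hU.diffAvg_iterate hTne l, ?_⟩
    rw [← expect_mul_diffAvg_iterate]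
    have h1 := hclose l U hU
    set h := (diffAvg T)^[l] (ind A - avg W (ind A)) with hh
    have hsq : (univ.expect fun u => h u ^ 2) ≤ (ζ ^ l) ^ 2 := by
      refine (expect_diffAvg_iterate_sq_le ψ hψ T hWne hb3 _
        (avg_commonKer_sub b (ind A)) l).trans ?_
      refine mul_le_of_le_one_right (by positivity) (expect_le univ_nonempty fun u _ => ?_)
      rw [sq_le_one_iff_abs_le_one, abs_le, Pi.sub_apply]
      have hw := (isWeight_ind A).avg hWne
      constructor <;> linarith [ind_nonneg A u, ind_le_one A u, hw.nonneg u, hw.le_one u]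
    have hcorr : ∀ u, |corr (ind L) h u| ≤ ζ ^ l := abs_corr_le
      (fun u => abs_le.2 ⟨by linarith [ind_nonneg L u], ind_le_one L u⟩) (by positivity) hsq
    have heq : corr (ind L) h = (diffAvg T)^[l] (corr (ind L) (ind A))
        - (diffAvg T)^[l] (corr (ind L) (avg W (ind A))) := by
      rw [hh, ← diffAvg_iterate_corr, corr_sub, diffAvg_iterate_sub]
    have h2 : |univ.expect fun u => U u * corr (ind L) h u| ≤ s * ζ ^ l := by
      refine (abs_expect_le _ _).trans ?_
      calc _ ≤ univ.expect fun u => U u * ζ ^ l := by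
            refine expect_le_expect fun u _ => ?_
            rw [abs_mul, abs_of_nonneg (hU.nonneg u)]
            exact mul_le_mul_of_nonneg_left (hcorr u) (hU.nonneg u)
        _ = _ := by rw [← expect_mul, hU.mean]
    simp only [heq, Pi.sub_apply, mul_sub, expect_sub_distrib] at h2
    rw [abs_le] at *
    constructor <;> linarith [h1.1, h1.2, h2.1, h2.2]

end

/-! ### Choice of parameters -/

lemma one_sub_le_log_one_div {x : ℝ} (hx : 0 < x) : 1 - x ≤ Real.log (1 / x) := by
  rw [one_div, Real.log_inv]
  linarith [Real.log_le_sub_one_of_pos hx]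

lemma rank_bound {α lam σ ζ d : ℝ} {n l : ℕ} (hl : 1 ≤ l) (hα : 0 < α) (hlam : 0 < lam)
    (hαl : lam / 2 ≤ 1 - α) (hζ : ζ = (lam * α / 32) ^ (l : ℝ)⁻¹)
    (hd : d * ζ ≤ 2 * (n * Real.log (1 / α) + Real.log 2)) (hn : 1 ≤ n * lam)
    (hn' : n ≤ 184320 * (l ^ 2 * Real.log (1 / σ) / lam ^ 2)) :
    d ≤ 10 ^ 8 * (lam ^ (-2 - 1 / (l : ℝ)) * α ^ (-1 / (l : ℝ)) * (l : ℝ) ^ 2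
      * Real.log (1 / α) * Real.log (1 / σ)) := by
  have hl' : (1 : ℝ) ≤ l := by exact_mod_cast hl
  have hζ0 : 0 < ζ := by rw [hζ]; positivity
  have hlog : lam / 2 ≤ Real.log (1 / α) := hαl.trans (one_sub_le_log_one_div hα)
  -- The `log 2` from halving the tuples is absorbed because `n λ ≥ 1` and `log (1 / α) ≥ λ / 2`.
  have hlog2 : Real.log 2 ≤ 2 * (n * Real.log (1 / α)) := by
    have h1 : (n : ℝ) * (lam / 2) ≤ n * Real.log (1 / α) := by gcongr
    have h2 : Real.log 2 ≤ 1 := by linarith [Real.log_two_lt_d9]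
    linarith
  have hinv : ζ⁻¹ ≤ 32 * (lam ^ (-(l : ℝ)⁻¹) * α ^ (-(l : ℝ)⁻¹)) := by
    rw [hζ, ← Real.rpow_neg (by positivity), Real.div_rpow (by positivity) (by norm_num),
      Real.mul_rpow hlam.le hα.le, div_eq_mul_inv, ← Real.rpow_neg (by norm_num), neg_neg, mul_comm]
    gcongr
    calc (32 : ℝ) ^ (l : ℝ)⁻¹ ≤ 32 ^ (1 : ℝ) := by
          gcongr
          · norm_num
          · exact inv_le_one_of_one_le₀ hl'
      _ = 32 := Real.rpow_one _
  have hK : lam ^ (-2 - 1 / (l : ℝ)) = lam ^ (-(l : ℝ)⁻¹) / lam ^ 2 := by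
    rw [show (-2 - 1 / (l : ℝ)) = -(l : ℝ)⁻¹ - (2 : ℕ) by push_cast; ring,
      Real.rpow_sub hlam, Real.rpow_natCast]
  have hK2 : α ^ (-1 / (l : ℝ)) = α ^ (-(l : ℝ)⁻¹) := by congr 1; ring
  have hlogpos : 0 < Real.log (1 / α) := lt_of_lt_of_le (by positivity) hlog
  have hd2 : d ≤ 6 * (n * Real.log (1 / α)) * ζ⁻¹ := by
    rw [← div_eq_mul_inv, le_div_iff₀ hζ0]; linarith
  rw [hK, hK2]
  set p := lam ^ (-(l : ℝ)⁻¹)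
  set r := α ^ (-(l : ℝ)⁻¹)
  have hp : 0 < p := by positivity
  have hr : 0 < r := by positivity
  calc d ≤ 6 * (n * Real.log (1 / α)) * ζ⁻¹ := hd2
    _ ≤ 6 * ((184320 * (l ^ 2 * Real.log (1 / σ) / lam ^ 2)) * Real.log (1 / α))
        * (32 * (p * r)) := by
        have h0 : (0 : ℝ) ≤ 184320 * (l ^ 2 * Real.log (1 / σ) / lam ^ 2) :=
          (Nat.cast_nonneg n).trans hn'
        gcongr
    _ = 35389440 * (p / lam ^ 2 * r * l ^ 2 * Real.log (1 / α) * Real.log (1 / σ)) := by ring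
    _ ≤ _ := by
        gcongr
        · have h0 : 0 ≤ l ^ 2 * Real.log (1 / σ) / lam ^ 2 := by
            by_contra h
            have : (0 : ℝ) ≤ n := Nat.cast_nonneg n
            linarith
          have e : p / lam ^ 2 * r * l ^ 2 * Real.log (1 / α) * Real.log (1 / σ)
              = p * r * Real.log (1 / α) * (l ^ 2 * Real.log (1 / σ) / lam ^ 2) := by ring
          rw [e]; positivity
        · norm_num

/-- With `m = ⌈log (1 / σ)⌉` the spare factor `3⁻¹ ^ m` pays for `σ`. As `log (1 / σ) ≥ 1/4`,
rounding up costs at most a factor `5`. -/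
lemma exists_sample_size_of_le {lam σ : ℝ} {l : ℕ} (hl : 1 ≤ l) (hlam : 0 < lam) (hlam1 : lam ≤ 1)
    (hσ : 0 < σ) (hσ1 : σ ≤ 3 / 4) :
    ∃ n m : ℕ, 1 ≤ n ∧ 1 ≤ m ∧
      (24 * m / n : ℝ) ^ m ≤ σ * (lam / (16 * l)) ^ (2 * m) ∧ 1 ≤ n * lam ∧
      (n : ℝ) ≤ 184320 * (l ^ 2 * Real.log (1 / σ) / lam ^ 2) := by
  have hl' : (1 : ℝ) ≤ l := by exact_mod_cast hl
  have hlog : 1 / 4 ≤ Real.log (1 / σ) := by linarith [one_sub_le_log_one_div hσ]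
  set m := ⌈Real.log (1 / σ)⌉₊ with hm
  have hm1 : 1 ≤ m := Nat.one_le_ceil_iff.2 (by linarith)
  have hm1' : (1 : ℝ) ≤ m := by exact_mod_cast hm1
  have hm2 : Real.log (1 / σ) ≤ m := Nat.le_ceil _
  have hm3 : (m : ℝ) ≤ 5 * Real.log (1 / σ) := by
    linarith [Nat.ceil_lt_add_one (show 0 ≤ Real.log (1 / σ) by linarith)]
  set Y : ℝ := 18432 * m * l ^ 2 / lam ^ 2 with hY
  have hY1 : 1 / lam ≤ Y := by
    rw [hY, div_le_div_iff₀ hlam (by positivity)]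
    have : 1 ≤ 18432 * (m : ℝ) * l ^ 2 := by
      nlinarith [one_le_pow₀ hl' (n := 2)]
    nlinarith
  have hYone : 1 ≤ Y := le_trans (by rw [le_div_iff₀ hlam]; linarith) hY1
  have hn1 : Y ≤ ⌈Y⌉₊ := Nat.le_ceil _
  refine ⟨⌈Y⌉₊, m, Nat.one_le_ceil_iff.2 (by linarith), hm1, ?_, ?_, ?_⟩
  · have h1 : (24 * m / ⌈Y⌉₊ : ℝ) ≤ (lam / (16 * l)) ^ 2 * 3⁻¹ := by
      calc (24 * m / ⌈Y⌉₊ : ℝ) ≤ 24 * m / Y := by gcongr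
        _ = _ := by rw [hY]; field_simp; norm_num
    have h2 : (3 : ℝ)⁻¹ ^ m ≤ σ := by
      have : Real.log ((3 : ℝ)⁻¹ ^ m) ≤ Real.log σ := by
        rw [Real.log_pow, Real.log_inv]
        rw [one_div, Real.log_inv] at hm2
        have h3 : 1 ≤ Real.log 3 := by
          rw [Real.le_log_iff_exp_le (by norm_num)]; linarith [Real.exp_one_lt_d9]
        nlinarith
      exact (Real.log_le_log_iff (by positivity) hσ).1 this
    calc _ ≤ ((lam / (16 * l)) ^ 2 * 3⁻¹) ^ m := by gcongr
      _ = 3⁻¹ ^ m * (lam / (16 * l)) ^ (2 * m) := by rw [mul_pow, ← pow_mul]; ring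
      _ ≤ _ := by gcongr
  · rw [← div_le_iff₀ hlam]; exact hY1.trans hn1
  · have : (⌈Y⌉₊ : ℝ) ≤ 2 * Y := by
      linarith [Nat.ceil_lt_add_one (show 0 ≤ Y by linarith)]
    refine this.trans ?_
    calc 2 * Y = 36864 * (l ^ 2 * m / lam ^ 2) := by rw [hY]; ring
      _ ≤ 36864 * (l ^ 2 * (5 * Real.log (1 / σ)) / lam ^ 2) := by gcongr
      _ = _ := by ring

/-- Second moments suffice here: the tolerated error grows like `1 / ε`, so `n` of order `ε l² / λ²`
is enough, and `ε ≤ log (1 / (1 - ε))`. -/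
lemma exists_sample_size_of_compl {lam ε : ℝ} {l : ℕ} (hl : 1 ≤ l) (hlam : 0 < lam)
    (hlam1 : lam ≤ 1) (hε : lam / 2 ≤ ε) (hε1 : ε < 1) :
    ∃ n : ℕ, 1 ≤ n ∧
      (24 * (1 : ℕ) / n : ℝ) ^ 1 ≤ ε * (lam / (32 * l * ε)) ^ (2 * 1) ∧ 1 ≤ n * lam ∧
      (n : ℝ) ≤ 184320 * (l ^ 2 * Real.log (1 / (1 - ε)) / lam ^ 2) := by
  have hl' : (1 : ℝ) ≤ l := by exact_mod_cast hl
  have hε0 : 0 < ε := by linarith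
  have hlog : ε ≤ Real.log (1 / (1 - ε)) := by
    linarith [one_sub_le_log_one_div (show 0 < 1 - ε by linarith)]
  set Y : ℝ := 24576 * ε * l ^ 2 / lam ^ 2 with hY
  have hY1 : 1 / lam ≤ Y := by
    rw [hY, div_le_div_iff₀ hlam (by positivity)]
    have : lam ≤ 24576 * ε * l ^ 2 := by
      nlinarith [one_le_pow₀ hl' (n := 2)]
    nlinarith
  have hYone : 1 ≤ Y := le_trans (by rw [le_div_iff₀ hlam]; linarith) hY1
  have hn1 : Y ≤ ⌈Y⌉₊ := Nat.le_ceil _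
  refine ⟨⌈Y⌉₊, Nat.one_le_ceil_iff.2 (by linarith), ?_, ?_, ?_⟩
  · rw [pow_one, Nat.cast_one, mul_one]
    calc (24 / ⌈Y⌉₊ : ℝ) ≤ 24 / Y := by gcongr
      _ = _ := by rw [hY, div_pow, mul_one, mul_pow, mul_pow]; field_simp; norm_num
  · rw [← div_le_iff₀ hlam]; exact hY1.trans hn1
  · have : (⌈Y⌉₊ : ℝ) ≤ 2 * Y := by
      linarith [Nat.ceil_lt_add_one (show 0 ≤ Y by linarith)]
    refine this.trans ?_
    calc 2 * Y = 49152 * (l ^ 2 * ε / lam ^ 2) := by rw [hY]; ring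
      _ ≤ 184320 * (l ^ 2 * Real.log (1 / (1 - ε)) / lam ^ 2) := by
          have : 0 ≤ l ^ 2 * ε / lam ^ 2 := by positivity
          gcongr
          norm_num

/-! ### The density increment on a vector space -/

section

variable {F V : Type*} [Field F] [AddCommGroup V] [Module F V] [Fintype V] [Fintype F]

theorem exists_density_increment (A L : Finset V) {U : V → ℝ} {σ : ℝ} (hU : IsWeight U σ)
    (hσ : 0 < σ) (hα : 0 < univ.expect (ind A)) (hlam : 0 < univ.expect (ind L))
    (hfail : (univ.expect fun u => U u * corr (ind L) (ind A) u)
      < univ.expect (ind L) * σ * univ.expect (ind A) / 2) {l : ℕ} (hl : 1 ≤ l) :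
    ∃ b : Finset (Dual F V),
      (b.card : ℝ) ≤ 10 ^ 8 * (univ.expect (ind L) ^ (-2 - 1 / (l : ℝ))
        * univ.expect (ind A) ^ (-1 / (l : ℝ)) * (l : ℝ) ^ 2
        * Real.log (1 / univ.expect (ind A)) * Real.log (1 / σ)) ∧
      univ.expect (ind (commonKer b)) = (Fintype.card F : ℝ)⁻¹ ^ b.card ∧
      ∃ y, univ.expect (ind A) * (1 + 1 / 4 * univ.expect (ind L))
        ≤ avg (commonKer b) (ind A) y := by
  have hA : A.Nonempty := by
    rw [nonempty_iff_ne_empty]; rintro rfl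
    rw [expect_ind] at hα; simp at hα
  have hmean : univ.expect (corr (ind L) (ind A)) = univ.expect (ind L) * univ.expect (ind A) :=
    expect_corr _ _
  have hα1 : univ.expect (ind A) ≤ 1 := expect_le univ_nonempty fun u _ => ind_le_one A u
  have hlam1 : univ.expect (ind L) ≤ 1 := expect_le univ_nonempty fun u _ => ind_le_one L u
  have hlow : ∀ u, univ.expect (ind L) - (1 - univ.expect (ind A)) ≤ corr (ind L) (ind A) u := by
    intro u
    have h1 : (univ.expect fun y => ind A (u + y)) = univ.expect (ind A) :=
      Fintype.expect_equiv (Equiv.addLeft u) _ _ fun _ => rfl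
    rw [← h1]
    calc _ = univ.expect fun y => ind L y - (1 - ind A (u + y)) := by
          rw [expect_sub_distrib, expect_sub_distrib, Fintype.expect_const]
      _ ≤ _ := by
          refine expect_le_expect fun y _ => ?_
          nlinarith [ind_le_one L y, ind_le_one A (u + y)]
  have hup : ∀ u, corr (ind L) (ind A) u ≤ univ.expect (ind A) := by
    intro u
    have h1 : (univ.expect fun y => ind A (u + y)) = univ.expect (ind A) :=
      Fintype.expect_equiv (Equiv.addLeft u) _ _ fun _ => rfl
    rw [← h1]
    refine expect_le_expect fun y _ => ?_
    exact mul_le_of_le_one_left (ind_nonneg _ _) (ind_le_one _ _)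
  set α := univ.expect (ind A) with hαdef
  set lam := univ.expect (ind L) with hlamdef
  have hl' : (1 : ℝ) ≤ l := by exact_mod_cast hl
  -- The correlation is at least `λ - (1 - α)` everywhere, so failure keeps `α` away from `1`.
  have hαl : lam / 2 ≤ 1 - α := by
    have h1 : σ * (lam - (1 - α)) ≤ univ.expect fun u => U u * corr (ind L) (ind A) u := by
      rw [← hU.mean, expect_mul]
      exact expect_le_expect fun u _ => mul_le_mul_of_nonneg_left (hlow u) (hU.nonneg u)
    have h2 : σ * (lam - (1 - α)) < σ * (lam / 2) := by nlinarith [mul_pos hlam hσ]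
    linarith [lt_of_mul_lt_mul_left h2 hσ.le]
  set ζ : ℝ := (lam * α / 32) ^ (l : ℝ)⁻¹ with hζ
  have hζ0 : 0 < ζ := by positivity
  have hζl : ζ ^ l = lam * α / 32 := Real.rpow_inv_natCast_pow (by positivity) (by omega)
  -- Near `σ = 1` the allowance `log (1 / σ)` is too small to pay for an integer `m ≥ 1`, so the
  -- weight is replaced by its complement.
  rcases le_or_gt σ (3 / 4) with hσ1 | hσ1
  · obtain ⟨n, m, hn, hm, hnm, hn1, hn2⟩ := exists_sample_size_of_le hl hlam hlam1 hσ hσ1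
    obtain ⟨b, hb1, hb2, hb3⟩ := exists_functionals (F := F) (l := l) A L hA hn hm hσ
      (show 0 ≤ lam / (16 * l) by positivity) hnm hζ0
    refine ⟨b, rank_bound hl hα hlam hαl hζ hb1 hn1 hn2, hb2, ?_⟩
    obtain ⟨U', hU', hclose⟩ := hb3 U hU
    have herr : (l : ℝ) * (2 * α * σ * (lam / (16 * l))) + σ * ζ ^ l ≤ lam * α * σ / 4 := by
      have : (l : ℝ) * (2 * α * σ * (lam / (16 * l))) = lam * α * σ / 8 := by
        field_simp; norm_num
      rw [this, hζl]; nlinarith [mul_pos (mul_pos hlam hα) hσ]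
    obtain ⟨u, hu⟩ : ∃ u, corr (ind L) (avg (commonKer b) (ind A)) u ≤ 3 / 4 * (lam * α) := by
      by_contra! H
      have h1 : σ * (3 / 4 * (lam * α))
          ≤ univ.expect fun u => U' u * corr (ind L) (avg (commonKer b) (ind A)) u := by
        rw [← hU'.mean, expect_mul]
        exact expect_le_expect fun u _ => mul_le_mul_of_nonneg_left (H u).le (hU'.nonneg u)
      linarith [(abs_le.1 (hclose.trans herr)).2]
    exact exists_avg_ge_of_corr_le (commonKer_nonempty b) hα hlam hu
  · have hV := hU.compl
    have hcompl : (univ.expect fun u => (1 - U u) * corr (ind L) (ind A) u)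
        = lam * α - univ.expect fun u => U u * corr (ind L) (ind A) u := by
      simp only [sub_mul, one_mul, expect_sub_distrib]
      rw [← hmean]
    set ε := 1 - σ with hε
    have hσε : σ = 1 - ε := by ring
    have hσ1' : σ ≤ 1 := by
      rw [← hU.mean]; exact expect_le univ_nonempty fun u _ => hU.le_one u
    have hgt : lam * α / 2 < univ.expect fun u => (1 - U u) * corr (ind L) (ind A) u := by
      rw [hcompl]; nlinarith [mul_pos hlam hα]
    -- The correlation never exceeds `α`, so a weight carrying more than `λα/2` cannot have small
    -- mean.
    have hεl : lam / 2 ≤ ε := by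
      have h1 : (univ.expect fun u => (1 - U u) * corr (ind L) (ind A) u) ≤ ε * α := by
        rw [← hV.mean, expect_mul]
        exact expect_le_expect fun u _ => mul_le_mul_of_nonneg_left (hup u) (hV.nonneg u)
      have h2 : lam / 2 * α < ε * α := by linarith
      exact (lt_of_mul_lt_mul_right h2 hα.le).le
    have hε0 : 0 < ε := by linarith
    obtain ⟨n, hn, hnm, hn1, hn2⟩ :=
      exists_sample_size_of_compl hl hlam hlam1 hεl (by linarith : ε < 1)
    rw [← hσε] at hn2
    obtain ⟨b, hb1, hb2, hb3⟩ := exists_functionals (F := F) (l := l) A L hA hn le_rfl hε0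
      (show 0 ≤ lam / (32 * l * ε) by positivity) hnm hζ0
    refine ⟨b, rank_bound hl hα hlam hαl hζ hb1 hn1 hn2, hb2, ?_⟩
    obtain ⟨U', hU', hclose⟩ := hb3 _ hV
    have herr : (l : ℝ) * (2 * α * ε * (lam / (32 * l * ε))) + ε * ζ ^ l ≤ lam * α / 8 := by
      have : (l : ℝ) * (2 * α * ε * (lam / (32 * l * ε))) = lam * α / 16 := by
        field_simp; norm_num
      rw [this, hζl]; nlinarith [mul_pos hlam hα]
    -- What remains is above `λα/2 - λα/8 = 3λα/8`, and `ε < 1/4`.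
    obtain ⟨u, hu⟩ : ∃ u, 3 / 2 * (lam * α) ≤ corr (ind L) (avg (commonKer b) (ind A)) u := by
      by_contra! H
      have h1 : (univ.expect fun u => U' u * corr (ind L) (avg (commonKer b) (ind A)) u)
          ≤ ε * (3 / 2 * (lam * α)) := by
        rw [← hU'.mean, expect_mul]
        exact expect_le_expect fun u _ => mul_le_mul_of_nonneg_left (H u).le (hU'.nonneg u)
      have h2 := (abs_le.1 (hclose.trans herr)).1
      nlinarith [mul_pos hlam hα]
    exact exists_avg_ge_of_le_corr hα hlam hu

end

/-! ### Reducing iterated convolutions to a single weight -/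

section

variable {V : Type*} [AddCommGroup V] [Fintype V]

lemma expect_conv (f g : V → ℝ) :
    univ.expect (conv univ f g) = univ.expect f * univ.expect g := by
  unfold conv
  rw [expect_comm, expect_mul]
  refine expect_congr rfl fun y _ => ?_
  rw [← mul_expect, expect_sub_right]

lemma conv_assoc (f g h : V → ℝ) :
    conv univ (conv univ f g) h = conv univ f (conv univ g h) := by
  funext x
  simp only [conv, expect_mul, mul_expect]
  rw [expect_comm]
  refine expect_congr rfl fun y _ => Fintype.expect_equiv (Equiv.subRight y) _ _ fun z => ?_
  rw [Equiv.subRight_apply, sub_sub_sub_cancel_right]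
  ring

lemma conv_nonneg {H : Type*} [AddCommGroup H] {X : Finset H} {f g : H → ℝ} (hf : ∀ x, 0 ≤ f x)
    (hg : ∀ x, 0 ≤ g x) (x : H) : 0 ≤ conv X f g x :=
  expect_nonneg fun _ _ => mul_nonneg (hf _) (hg _)

/-- Associativity gathers all factors after `f`; the empty product is the normalised point mass at
`0`. -/
lemma exists_iterConv_eq_conv (f : V → ℝ) (k : ℕ) (g : Fin k → V → ℝ) (hg : ∀ i x, 0 ≤ g i x) :
    ∃ P : V → ℝ, (∀ x, 0 ≤ P x) ∧ univ.expect P = ∏ i, univ.expect (g i) ∧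
      iterConv univ f k g = conv univ f P := by
  classical
  have hN : (Fintype.card V : ℝ) ≠ 0 := by exact_mod_cast Fintype.card_pos.ne'
  induction k with
  | zero =>
    refine ⟨fun x => if x = 0 then (Fintype.card V : ℝ) else 0, fun x => ?_, ?_, ?_⟩
    · dsimp only
      split_ifs <;> positivity
    · rw [Fintype.expect_eq_sum_div_card]
      simp [hN]
    · funext x
      rw [iterConv, conv, Fintype.expect_eq_sum_div_card]
      simp [sub_eq_zero, hN]
  | succ k ih =>
    obtain ⟨P, hP0, hP1, hP2⟩ := ih (fun i => g i.castSucc) fun i x => hg _ x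
    refine ⟨conv univ P (g (Fin.last k)), conv_nonneg hP0 (hg _), ?_, ?_⟩
    · rw [expect_conv, hP1, Fin.prod_univ_castSucc]
    · rw [iterConv, hP2, conv_assoc]

lemma innerOn_conv (f g h : V → ℝ) :
    innerOn univ (conv univ f g) h = univ.expect fun u => g u * corr f h u := by
  simp only [innerOn, conv, corr, expect_mul, mul_expect]
  rw [expect_comm]
  conv_rhs => rw [expect_comm]
  refine expect_congr rfl fun y _ => Fintype.expect_equiv (Equiv.subRight y) _ _ fun x => ?_
  rw [Equiv.subRight_apply, sub_add_cancel]
  ring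

end

section

variable {F V : Type*} [Field F] [AddCommGroup V] [Module F V] [Fintype V] [Fintype F]

lemma exists_density_increment_of_iterConv {k : ℕ} (A L : Finset V) (S : Fin (k + 1) → Finset V)
    (hfail : innerOn univ (iterConv univ (ind L) (k + 1) fun i => ind (S i)) (ind A)
      < univ.expect (ind L) * (∏ i, univ.expect (ind (S i))) * univ.expect (ind A) / 2)
    {l : ℕ} (hl : 1 ≤ l) :
    ∃ b : Finset (Dual F V),
      (b.card : ℝ) ≤ 10 ^ 8 * (univ.expect (ind L) ^ (-2 - 1 / (l : ℝ))
        * univ.expect (ind A) ^ (-1 / (l : ℝ)) * (l : ℝ) ^ 2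
        * Real.log (1 / univ.expect (ind A))
        * Real.log (1 / univ.expect (ind (S (Fin.last k))))) ∧
      univ.expect (ind (commonKer b)) = (Fintype.card F : ℝ)⁻¹ ^ b.card ∧
      ∃ y, univ.expect (ind A) * (1 + 1 / 4 * univ.expect (ind L))
        ≤ avg (commonKer b) (ind A) y := by
  obtain ⟨P, hP0, hP1, hP2⟩ := exists_iterConv_eq_conv (ind L) k (fun i => ind (S i.castSucc))
    fun i x => ind_nonneg _ x
  have h0 : ∀ X : Finset V, 0 ≤ univ.expect (ind X) := fun X => expect_nonneg fun x _ =>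
    ind_nonneg X x
  rw [iterConv, hP2, conv_assoc, innerOn_conv, Fin.prod_univ_castSucc, ← hP1] at hfail
  set σ := univ.expect (ind (S (Fin.last k)))
  set π := univ.expect P
  have hπ0 : 0 ≤ π := expect_nonneg fun x _ => hP0 x
  -- The inner product is nonnegative, so strict failure forces all densities to be positive.
  have hpos : 0 < univ.expect (ind L) * (π * σ) * univ.expect (ind A) := by
    have : 0 ≤ univ.expect fun u =>
        conv univ P (ind (S (Fin.last k))) u * corr (ind L) (ind A) u :=
      expect_nonneg fun u _ => mul_nonneg (conv_nonneg hP0 (ind_nonneg _) u)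
        (expect_nonneg fun y _ => mul_nonneg (ind_nonneg _ _) (ind_nonneg _ _))
    linarith
  have hα : 0 < univ.expect (ind A) := pos_of_mul_pos_right hpos
    (mul_nonneg (h0 L) (mul_nonneg hπ0 (h0 _)))
  have h1 : 0 < univ.expect (ind L) * (π * σ) := pos_of_mul_pos_left hpos hα.le
  have hlam : 0 < univ.expect (ind L) := pos_of_mul_pos_left h1 (mul_nonneg hπ0 (h0 _))
  have h2 : 0 < π * σ := pos_of_mul_pos_right h1 hlam.le
  have hσ : 0 < σ := pos_of_mul_pos_right h2 hπ0
  have hπ : 0 < π := pos_of_mul_pos_left h2 hσ.le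
  have hU : IsWeight (fun u => conv univ P (ind (S (Fin.last k))) u / π) σ := by
    refine ⟨fun u => div_nonneg (conv_nonneg hP0 (ind_nonneg _) u) hπ.le, fun u => ?_, ?_⟩
    · rw [div_le_one hπ]
      exact expect_le_expect fun y _ => mul_le_of_le_one_right (hP0 y) (ind_le_one _ _)
    · rw [← expect_div, show (univ.expect fun u => conv univ P (ind (S (Fin.last k))) u)
        = π * σ from expect_conv _ _]
      field_simp
  refine exists_density_increment A L hU hσ hα hlam ?_ hl
  have h3 : (univ.expect fun u => conv univ P (ind (S (Fin.last k))) u / π * corr (ind L) (ind A) u)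
      = (univ.expect fun u => conv univ P (ind (S (Fin.last k))) u * corr (ind L) (ind A) u)
        / π := by
    rw [expect_div]
    exact expect_congr rfl fun u _ => by ring
  rw [h3, div_lt_iff₀ hπ]
  linarith

end

/-! ### Transfer to the subspace underlying a Bohr set -/

section

lemma ind_congr {H H' : Type*} {A : Finset H} {A' : Finset H'} {x : H} {x' : H'}
    (h : x ∈ A ↔ x' ∈ A') : ind A x = ind A' x' := by
  unfold ind
  by_cases hx : x ∈ A
  · rw [if_pos hx, if_pos (h.1 hx)]
  · rw [if_neg hx, if_neg (mt h.2 hx)]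

lemma density_eq_expect {H : Type*} (X A : Finset H) : density X A = X.expect (ind A) := by
  classical
  rw [expect_eq_sum_div_card]
  unfold density ind
  congr 1
  rw [Finset.inter_comm, ← Finset.filter_mem_eq_inter]
  simp only [sum_boole]

variable {H F : Type*} [AddCommGroup H] [Field F] [Module F H] {X : Finset H} {W : Submodule F H} [Fintype W]

lemma expect_eq_expect_submodule (hX : ∀ x, x ∈ X ↔ x ∈ W) (f : H → ℝ) :
    X.expect f = univ.expect fun w : W => f w := by
  refine (expect_bij (fun (w : W) _ => (w : H)) (fun w _ => (hX _).2 w.2) (fun _ _ => rfl)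
    (fun _ _ _ _ h => Subtype.ext h) fun x hx => ⟨⟨x, (hX x).1 hx⟩, mem_univ _, rfl⟩).symm

lemma conv_submodule (hX : ∀ x, x ∈ X ↔ x ∈ W) (f g : H → ℝ) (w : W) :
    conv X f g w = conv univ (fun v : W => f v) (fun v : W => g v) w := by
  unfold conv
  rw [expect_eq_expect_submodule hX]
  rfl

lemma iterConv_submodule (hX : ∀ x, x ∈ X ↔ x ∈ W) (f : H → ℝ) (k : ℕ) (g : Fin k → H → ℝ)
    (w : W) :
    iterConv X f k g w = iterConv univ (fun v : W => f v) k (fun i (v : W) => g i v) w := by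
  induction k generalizing w with
  | zero => rfl
  | succ k ih =>
    rw [iterConv, iterConv, conv_submodule hX]
    congr 1
    funext v
    exact ih _ v

open Classical in
/-- The elements of a submodule that belong to a given finite set. -/
noncomputable def restrict (W : Submodule F H) [Fintype W] (A : Finset H) : Finset W :=
  univ.filter fun w => (w : H) ∈ A

lemma mem_restrict {A : Finset H} {w : W} : w ∈ restrict W A ↔ (w : H) ∈ A := by
  simp [restrict]

lemma ind_restrict (A : Finset H) (w : W) : ind (restrict W A) w = ind A w :=
  ind_congr mem_restrict

lemma density_eq_expect_restrict (hX : ∀ x, x ∈ X ↔ x ∈ W) (A : Finset H) :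
    density X A = univ.expect (ind (restrict W A)) := by
  rw [density_eq_expect, expect_eq_expect_submodule hX]
  exact expect_congr rfl fun w _ => (ind_restrict A w).symm

lemma innerOn_iterConv_restrict (hX : ∀ x, x ∈ X ↔ x ∈ W) {k : ℕ} (A L : Finset H)
    (S : Fin k → Finset H) :
    innerOn X (iterConv X (ind L) k fun i => ind (S i)) (ind A)
      = innerOn univ (iterConv univ (ind (restrict W L)) k fun i => ind (restrict W (S i)))
        (ind (restrict W A)) := by
  unfold innerOn
  rw [expect_eq_expect_submodule hX]
  refine expect_congr rfl fun w _ => ?_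
  rw [iterConv_submodule hX, ind_restrict]
  congr 3
  · funext v; rw [ind_restrict]
  · funext i v; rw [ind_restrict]

lemma density_translate_eq_avg {Y : Finset H} {K : Finset W}
    (hY : ∀ x, x ∈ Y ↔ ∃ w ∈ K, (w : H) = x) (A : Finset H) (y : W) :
    density Y (translate A (-y : W)) = avg K (ind (restrict W A)) y := by
  rw [density_eq_expect]
  refine (expect_bij (fun (w : W) _ => (w : H)) (fun w hw => (hY _).2 ⟨w, hw, rfl⟩) (fun w _ => ?_)
    (fun _ _ _ _ h => Subtype.ext h) fun x hx => ?_).symm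
  · rw [ind_restrict]
    have : ((y + w : W) : H) ∈ A ↔ (w : H) ∈ translate A (-y : W) := by
      rw [translate, mem_map]
      refine ⟨fun h => ⟨_, h, by simp⟩, ?_⟩
      rintro ⟨a, ha, he⟩
      rw [Submodule.coe_add, ← he]
      simpa using ha
    exact ind_congr this
  · obtain ⟨w, hw, rfl⟩ := (hY x).1 hx
    exact ⟨w, hw, rfl⟩

end

/-! ### Bohr sets as subspaces, and cutting them by functionals -/

section

variable {F : Type*} [Field F]

/-- The strict inequality kills exactly the coefficients of `t⁻¹, …, t⁻ᵏ`, which are linear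
conditions. -/
lemma deg_fract_lt_iff (y : Kinf F) (k : ℕ) :
    deg (fract y) < ((-(k : ℤ) : ℤ) : WithBot ℤ) ↔ ∀ n : ℤ, 0 < n → n ≤ k → y.coeff n = 0 := by
  have hc : ∀ n : ℤ, (fract y).coeff n = if 0 < n then y.coeff n else 0 := fun n => rfl
  unfold deg
  split_ifs with h
  · simp only [WithBot.bot_lt_coe, true_iff]
    intro n hn _
    have := hc n
    rw [h, if_pos hn] at this
    simpa using this.symm
  · rw [WithBot.coe_lt_coe, neg_lt_neg_iff]
    have h0 := HahnSeries.coeff_order_eq_zero.not.2 h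
    rw [hc] at h0
    constructor
    · intro hk n hn hnk
      have := HahnSeries.coeff_eq_zero_of_lt_order (lt_of_le_of_lt hnk hk)
      rwa [hc, if_pos hn] at this
    · intro H
      by_contra! hk
      split_ifs at h0 with hpos
      · exact h0 (H _ hpos hk)
      · exact h0 rfl

lemma polyIncl_C (c : F) : polyIncl F (Polynomial.C c) = HahnSeries.C c := by
  rw [polyIncl, Polynomial.aeval_C, LaurentSeries.algebraMap_apply]

/-- The frequency representing a linear functional on `G F N`. -/
noncomputable def frequency (N : ℕ) (φ : Dual F (G F N)) : Kinf F :=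
  ∑ j : Fin N, HahnSeries.single ((j : ℤ) + 1)
    (φ ((Polynomial.degreeLTEquiv F N).symm fun i => if j = i then 1 else 0))

lemma frequency_mem_dualT (N : ℕ) (φ : Dual F (G F N)) : frequency N φ ∈ dualT F := by
  intro n hn
  rw [frequency, HahnSeries.coeff_sum]
  refine sum_eq_zero fun j _ => HahnSeries.coeff_single_of_ne ?_
  omega

/-- With `ξ = ∑ φ(tʲ) t^(-j-1)`, only the diagonal terms `x_j tʲ · φ(tʲ) t^(-j-1)` contribute to
`t⁻¹`. -/
lemma coeff_polyIncl_mul_frequency (N : ℕ) (φ : Dual F (G F N)) (x : G F N) :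
    (polyIncl F (x : Polynomial F) * frequency N φ).coeff 1 = φ x := by
  set e := Polynomial.degreeLTEquiv F N
  have h1 : φ x = ∑ j : Fin N, (x : Polynomial F).coeff j
      * φ (e.symm fun i => if j = i then 1 else 0) := by
    have := LinearMap.pi_apply_eq_sum_univ (φ ∘ₗ e.symm.toLinearMap) (e x)
    rw [LinearMap.comp_apply, LinearEquiv.coe_coe, e.symm_apply_apply] at this
    exact this
  have h2 : polyIncl F (x : Polynomial F)
      = ∑ j : Fin N, HahnSeries.single (-(j : ℤ)) ((x : Polynomial F).coeff j) := by
    have hdeg : (x : Polynomial F).degree < N := Polynomial.mem_degreeLT.1 x.2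
    rcases eq_or_ne (x : Polynomial F) 0 with hx | hx
    · simp [hx]
    rw [polyIncl, Polynomial.aeval_def, Polynomial.eval₂_eq_sum_range' _ (n := N)]
    · rw [Finset.sum_range]
      refine sum_congr rfl fun j _ => ?_
      rw [HahnSeries.single_pow, one_pow, LaurentSeries.algebraMap_apply,
        HahnSeries.C_apply, HahnSeries.single_mul_single]
      simp
    · exact (Polynomial.natDegree_lt_iff_degree_lt hx).2 hdeg
  rw [h1, h2, frequency, sum_mul, HahnSeries.coeff_sum]
  refine sum_congr rfl fun j _ => ?_
  rw [mul_sum, HahnSeries.coeff_sum, sum_eq_single j]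
  · rw [HahnSeries.single_mul_single]
    simp [e]
  · intro i _ hij
    rw [HahnSeries.single_mul_single]
    refine HahnSeries.coeff_single_of_ne ?_
    intro h
    apply hij
    ext
    omega
  · simp

open Classical in
/-- The Bohr set cut out of `B` by a finite set of functionals. -/
noncomputable def Bohr.cut (B : Bohr F) (N : ℕ) (b : Finset (Dual F (G F N))) : Bohr F where
  Γ := B.Γ ∪ b.image (frequency N)
  subset_dual := by
    intro ξ hξ
    rw [mem_coe, mem_union, mem_image] at hξ
    rcases hξ with h | ⟨φ, _, rfl⟩
    · exact B.subset_dual h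
    · exact frequency_mem_dualT N φ
  -- The value `0` imposes no condition and `1` tests only `t⁻¹`; the maximum gives the intersection
  -- when a new frequency is already in `Γ`.
  κ ξ := max (if h : (ξ : Kinf F) ∈ B.Γ then B.κ ⟨ξ, h⟩ else 0)
    (if (ξ : Kinf F) ∈ b.image (frequency N) then 1 else 0)

lemma Bohr.rk_cut_le (B : Bohr F) (N : ℕ) (b : Finset (Dual F (G F N))) :
    (B.cut N b).rk ≤ B.rk + b.card := by
  classical
  refine (card_union_le _ _).trans ?_
  exact Nat.add_le_add_left card_image_le _

variable [Fintype F]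

lemma mem_set_iff (B : Bohr F) (N : ℕ) (x : G F N) :
    x ∈ B.set N ↔ ∀ ξ : {ξ // ξ ∈ B.Γ}, ∀ n : ℤ, 0 < n → n ≤ B.κ ξ →
      (polyIncl F (x : Polynomial F) * (ξ : Kinf F)).coeff n = 0 := by
  simp only [Bohr.set, mem_filter, mem_univ, true_and, deg_fract_lt_iff]

/-- The subspace of `G F N` formed by the elements of a Bohr set. -/
def Bohr.submodule (B : Bohr F) (N : ℕ) : Submodule F (G F N) where
  carrier := {x | x ∈ B.set N}
  zero_mem' := by
    simp only [Set.mem_ofPred_eq, mem_set_iff]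
    intro ξ n _ _
    simp
  add_mem' := by
    intro x y hx hy
    simp only [Set.mem_ofPred_eq, mem_set_iff] at *
    intro ξ n h1 h2
    rw [Submodule.coe_add, map_add, add_mul, HahnSeries.coeff_add, hx ξ n h1 h2, hy ξ n h1 h2,
      add_zero]
  smul_mem' := by
    intro c x hx
    simp only [Set.mem_ofPred_eq, mem_set_iff] at *
    intro ξ n h1 h2
    rw [Submodule.coe_smul, Polynomial.smul_eq_C_mul, map_mul, polyIncl_C, mul_assoc,
      HahnSeries.C_mul_eq_smul, HahnSeries.coeff_smul, hx ξ n h1 h2, smul_zero]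

lemma mem_set_iff_mem_submodule (B : Bohr F) (N : ℕ) (x : G F N) :
    x ∈ B.set N ↔ x ∈ B.submodule N := Iff.rfl

lemma Bohr.mem_set_cut (B : Bohr F) (N : ℕ) (b : Finset (Dual F (G F N))) (x : G F N) :
    x ∈ (B.cut N b).set N ↔ x ∈ B.set N ∧ ∀ φ ∈ b, φ x = 0 := by
  classical
  rw [mem_set_iff, mem_set_iff]
  constructor
  · refine fun h => ⟨fun ξ n hn hnk => ?_, fun φ hφ => ?_⟩
    · refine h ⟨ξ, mem_union_left _ ξ.2⟩ n hn (hnk.trans ?_)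
      simp [Bohr.cut]
    · rw [← coeff_polyIncl_mul_frequency]
      refine h ⟨frequency N φ, mem_union_right _ (mem_image_of_mem _ hφ)⟩ 1 one_pos ?_
      have : frequency N φ ∈ b.image (frequency N) := mem_image_of_mem _ hφ
      simp only [Bohr.cut, if_pos this]
      exact_mod_cast le_max_right _ _
  · rintro ⟨h1, h2⟩ ⟨ξ, hξ⟩ n hn hnk
    simp only [Bohr.cut, Nat.cast_max, le_max_iff] at hnk
    rcases hnk with hnk | hnk
    · split_ifs at hnk with h
      · exact h1 ⟨ξ, h⟩ n hn hnk
      · simp only [Nat.cast_zero] at hnk; omega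
    · split_ifs at hnk with h
      · obtain ⟨φ, hφ, rfl⟩ := mem_image.1 h
        obtain rfl : n = 1 := by simp only [Nat.cast_one] at hnk; omega
        rw [coeff_polyIncl_mul_frequency, h2 φ hφ]
      · simp only [Nat.cast_zero] at hnk; omega

end

end FqtBohr

/-! ### The density increment for Bohr sets -/

theorem mainTheorem6 (q : ℕ) :
    ∃ C c : ℝ, 0 < C ∧ 0 < c ∧
      ∀ (F : Type*) [Field F] [Fintype F], Fintype.card F = q →
      ∀ (N k : ℕ) (B : FqtBohr.Bohr F)
        (A L : Finset (FqtBohr.G F N)) (S : Fin (k + 1) → Finset (FqtBohr.G F N)),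
        A ⊆ B.set N → L ⊆ B.set N → (∀ i, S i ⊆ B.set N) →
        ∀ (α lam : ℝ) (σ : Fin (k + 1) → ℝ),
          α = FqtBohr.density (B.set N) A →
          lam = FqtBohr.density (B.set N) L →
          (∀ i, σ i = FqtBohr.density (B.set N) (S i)) →
          (FqtBohr.innerOn (B.set N)
              (FqtBohr.iterConv (B.set N) (FqtBohr.ind L) (k + 1) fun i => FqtBohr.ind (S i))
              (FqtBohr.ind A)
            ≥ lam * (∏ i, σ i) * α / 2) ∨
          (∀ l : ℕ, 1 ≤ l →
            ∃ B' : FqtBohr.Bohr F, B'.set N ⊆ B.set N ∧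
              (B'.rk : ℝ) ≤ B.rk +
                C * (lam ^ (-2 - 1 / (l : ℝ)) * α ^ (-1 / (l : ℝ)) * (l : ℝ) ^ 2
                  * Real.log (1 / α) * Real.log (1 / σ (Fin.last k))) ∧
              FqtBohr.density (B.set N) (B'.set N) ≥
                Real.exp (-C * (lam ^ (-2 - 1 / (l : ℝ)) * α ^ (-1 / (l : ℝ)) * (l : ℝ) ^ 2
                  * Real.log (1 / α) * Real.log (1 / σ (Fin.last k)))) ∧
              ∃ x ∈ B.set N,
                FqtBohr.density (B'.set N) (FqtBohr.translate A x) ≥ α * (1 + c * lam)) := by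
  classical
  have hlogq : 0 ≤ Real.log q := Real.log_natCast_nonneg q
  -- The `1` serves the rank; `log q` turns the density `q ^ (-b.card)` into an exponential.
  refine ⟨10 ^ 8 * (1 + Real.log q), 1 / 4, by positivity, by norm_num, ?_⟩
  intro F _ _ hq N k B A L S _ _ _ α lam σ hα hlam hσ
  have hX := FqtBohr.mem_set_iff_mem_submodule B N
  set W := B.submodule N with hW
  rw [FqtBohr.density_eq_expect_restrict hX] at hα hlam
  simp only [FqtBohr.density_eq_expect_restrict hX] at hσ
  rw [FqtBohr.innerOn_iterConv_restrict hX, or_iff_not_imp_left, ge_iff_le, not_le]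
  intro hfail l hl
  simp only [hσ] at hfail ⊢
  rw [hα, hlam] at hfail ⊢
  obtain ⟨b, hb1, hb2, y, hy⟩ := FqtBohr.exists_density_increment_of_iterConv (F := F)
    (FqtBohr.restrict W A) (FqtBohr.restrict W L) (fun i => FqtBohr.restrict W (S i)) hfail hl
  set K := Finset.univ.expect (FqtBohr.ind (FqtBohr.restrict W L)) ^ (-2 - 1 / (l : ℝ))
    * Finset.univ.expect (FqtBohr.ind (FqtBohr.restrict W A)) ^ (-1 / (l : ℝ)) * (l : ℝ) ^ 2
    * Real.log (1 / Finset.univ.expect (FqtBohr.ind (FqtBohr.restrict W A)))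
    * Real.log (1 / Finset.univ.expect (FqtBohr.ind (FqtBohr.restrict W (S (Fin.last k)))))
  -- Frequencies represent functionals on all of `G F N`, so those found on `W` are extended first.
  choose ext hext using fun φ : Module.Dual F W => LinearMap.exists_extend φ
  have hext' : ∀ φ (w : W), ext φ w = φ w := fun φ w => LinearMap.congr_fun (hext φ) w
  have hb0 : (0 : ℝ) ≤ b.card := Nat.cast_nonneg _
  have hmem : ∀ x, x ∈ (B.cut N (b.image ext)).set N ↔
      ∃ w : W, w ∈ FqtBohr.commonKer b ∧ (w : FqtBohr.G F N) = x := by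
    intro x
    rw [FqtBohr.Bohr.mem_set_cut]
    constructor
    · rintro ⟨hx, hφ⟩
      refine ⟨⟨x, (hX x).1 hx⟩, FqtBohr.mem_commonKer.2 fun φ hb => ?_, rfl⟩
      rw [← hext']
      exact hφ _ (Finset.mem_image_of_mem _ hb)
    · rintro ⟨w, hw, rfl⟩
      refine ⟨(hX _).2 w.2, fun φ hφ => ?_⟩
      obtain ⟨χ, hχ, rfl⟩ := Finset.mem_image.1 hφ
      rw [hext', FqtBohr.mem_commonKer.1 hw χ hχ]
  refine ⟨B.cut N (b.image ext), fun x hx => ((B.mem_set_cut N _ x).1 hx).1, ?_, ?_,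
    ((-y : W) : FqtBohr.G F N), (hX _).2 (-y : W).2, ?_⟩
  · have h1 : ((B.cut N (b.image ext)).rk : ℝ) ≤ B.rk + b.card := by
      exact_mod_cast (B.rk_cut_le N _).trans (Nat.add_le_add_left Finset.card_image_le _)
    nlinarith
  · have h1 : FqtBohr.restrict W ((B.cut N (b.image ext)).set N) = FqtBohr.commonKer b := by
      ext w
      rw [FqtBohr.mem_restrict, hmem]
      simp
    have hq0 : (0 : ℝ) < q := by rw [← hq]; exact_mod_cast Fintype.card_pos
    rw [FqtBohr.density_eq_expect_restrict hX, h1, hb2, hq, ge_iff_le,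
      ← Real.le_log_iff_exp_le (by positivity), Real.log_pow, Real.log_inv]
    nlinarith
  · rw [FqtBohr.density_translate_eq_avg hmem]
    exact hy
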